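/- Setting. For $n\ge 2$ let $\Delta_n$ be the probability simplex in $\mathbb R^n$; a pair $(x,y)\in\Delta_n\times\Delta_n$ is called an instance. For $\alpha\ge 0$ let $$\mathcal G_\alpha(x,y)=\{(A,B): A,B\in[-1,1]^{n\times n},\ x^\top A y\le e_i^\top A y+\alpha \text{ and } x^\top B y\le x^\top B e_j+\alpha \text{ for all } i,j\}$$ (general-sum games) and $$\mathcal Z_\alpha(x,y)=\{A\in[-1,1]^{n\times n}: x^\top A e_j-\alpha\le x^\top A y\le e_i^\top A y+\alpha \text{ for all } i,j\}$$ (zero-sum games) be the sets of games for which $(x,y)$ is an $\alpha$-Nash equilibrium. A (possibly randomised) learning algorithm observes i.i.d. action pairs $(X_t,Y_t)\sim x\otimes y$ one at a time, stops at a stopping time $\tau_\delta$ of its observations (and internal randomness), and then returns a set $\hat{\mathcal G}$ of pairs of matrices (respectively a set $\hat{\mathcal Z}$ of matrices). It is $(\epsilon,\delta)$-correct if, for every instance $(x,y)$, the probability that it stops and returns a set with $H(\mathcal G_\alpha(x,y),\hat{\mathcal G})\ge\epsilon$ (respectively $H(\mathcal Z_\alpha(x,y),\hat{\mathcal Z})\ge\epsilon$)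 is at most $\delta$, where $H$ is the ($[0,\infty]$-valued) Hausdorff distance for the entrywise $\ell_\infty$ metric. Theorem. There is a universal constant $c>0$ such that for all $n\ge2$, $\alpha\in(0,1/4)$ and $\epsilon\in(0,1/128]$ there exist an instance $(x^0,y^0)$ and a finitely supported probability distribution $\nu$ on instances, depending only on $n,\alpha,\epsilon$, such that for every $\delta\in(0,1/2]$ and every $(\epsilon,\delta)$-correct algorithm: 1. $\displaystyle \mathbb E_{x^0,y^0}[\tau_\delta]\ \ge\ c\,\frac{\log(1/\delta)}{\epsilon^2\alpha}$; 2. $\displaystyle \mathbb E_{(x,y)\sim\nu}\,\mathbb E_{x,y}[\tau_\delta]\ \ge\ c\,\frac{n+\log(1/\delta)}{\epsilon^2\alpha}$; 3. there is an instance $(x,y)$ in the support of $\nu$ (which may depend on the algorithm) with $\displaystyle \mathbb E_{x,y}[\tau_\delta]\ \ge\ c\,\frac{n+\log(1/\delta)}{\epsilon^2\alpha}$. This holds both for general-sum games (algorithms that are $(\epsilon,\delta)$-correct for $\mathcal G_\alpha$) and for zero-sum games (algorithms that are $(\epsilon,\delta)$-correct for $\mathcal Z_\alpha$), with the same $c$,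 $(x^0,y^0)$ and $\nu$. -/

import Mathlib

open MeasureTheory
open scoped ENNReal

/-- An `n × n` real matrix. As an iterated function space it carries the entrywise `ℓ∞` metric,
and pairs of such matrices carry the maximum of the two `ℓ∞` distances. -/
abbrev PayoffMatrix (n : ℕ) : Type := Fin n → Fin n → ℝ

/-- A problem instance: a pair `(x, y)` of mixed strategies in `Δ_n × Δ_n`. -/
abbrev Profile (n : ℕ) : Type := stdSimplex ℝ (Fin n) × stdSimplex ℝ (Fin n)

/-- The expected loss `xᵀ A y`. -/
def expectedLoss {n : ℕ} (x : Fin n → ℝ) (A : PayoffMatrix n) (y : Fin n → ℝ) : ℝ :=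
  ∑ i, ∑ j, x i * A i j * y j

/-- The `i`-th standard basis vector of `ℝⁿ`. -/
def pureStrategy {n : ℕ} (i : Fin n) : Fin n → ℝ := Pi.single i 1

/-- The matrices `[-1,1]^{n × n}`. -/
def boundedMatrices (n : ℕ) : Set (PayoffMatrix n) :=
  {A | ∀ i j, A i j ∈ Set.Icc (-1 : ℝ) 1}

/-- General-sum games: all pairs `(A, B)` of matrices with entries in `[-1,1]` for which the
profile `z = (x, y)` is an `α`-Nash equilibrium (both players minimise their loss). -/
def feasibleGeneralSum {n : ℕ} (α : ℝ) (z : Profile n) :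
    Set (PayoffMatrix n × PayoffMatrix n) :=
  {M | M.1 ∈ boundedMatrices n ∧ M.2 ∈ boundedMatrices n ∧
    (∀ i, expectedLoss z.1.1 M.1 z.2.1 ≤ expectedLoss (pureStrategy i) M.1 z.2.1 + α) ∧
    (∀ j, expectedLoss z.1.1 M.2 z.2.1 ≤ expectedLoss z.1.1 M.2 (pureStrategy j) + α)}

/-- Zero-sum games: all matrices `A` with entries in `[-1,1]` for which the profile `z = (x, y)`
is an `α`-Nash equilibrium of the zero-sum game `A`. -/
def feasibleZeroSum {n : ℕ} (α : ℝ) (z : Profile n) : Set (PayoffMatrix n) :=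
  {A | A ∈ boundedMatrices n ∧
    ∀ i j, expectedLoss z.1.1 A (pureStrategy j) - α ≤ expectedLoss z.1.1 A z.2.1 ∧
      expectedLoss z.1.1 A z.2.1 ≤ expectedLoss (pureStrategy i) A z.2.1 + α}

/-- A mixed strategy as a probability mass function on the actions. -/
noncomputable def strategyPMF {n : ℕ} (x : stdSimplex ℝ (Fin n)) : PMF (Fin n) :=
  PMF.ofFintype (fun i => ENNReal.ofReal (x.1 i)) (by
    rw [← ENNReal.ofReal_sum_of_nonneg (fun i _ => x.2.1 i), x.2.2, ENNReal.ofReal_one])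

/-- The law `x ⊗ y` of one observation `(X_t, Y_t)`. -/
noncomputable def roundLaw {n : ℕ} (z : Profile n) : Measure (Fin n × Fin n) :=
  (strategyPMF z.1).toMeasure.prod (strategyPMF z.2).toMeasure

instance {n : ℕ} (z : Profile n) : IsProbabilityMeasure (roundLaw z) := by
  unfold roundLaw
  infer_instance

/-- The law of the i.i.d. sequence of observations `(X_t, Y_t)`, `t ∈ ℕ`. -/
noncomputable def sampleLaw {n : ℕ} (z : Profile n) : Measure (ℕ → Fin n × Fin n) :=
  Measure.infinitePi (fun _ : ℕ => roundLaw z)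

/-- The list of the first `t` observations. -/
def history {n : ℕ} (ω : ℕ → Fin n × Fin n) (t : ℕ) : List (Fin n × Fin n) :=
  (List.range t).map ω

/-- A (possibly randomised) learning algorithm observing action pairs sequentially. It may draw an
internal random seed, independent of the data. `stopsAt u h` says that with seed `u` the algorithm
stops when the history `h` has been observed, and `recommend u h` is then the set it returns. The
stopping decision and the recommendation see only the seed and the past observations. -/
structure LearningAlgorithm (n : ℕ) (P : Type) where
  Seed : Type
  [measurableSpaceSeed : MeasurableSpace Seed]
  seedLaw : Measure Seed
  [isProbabilityMeasure_seedLaw : IsProbabilityMeasure seedLaw]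
  stopsAt : Seed → List (Fin n × Fin n) → Prop
  measurableSet_stopsAt : ∀ h, MeasurableSet {u | stopsAt u h}
  recommend : Seed → List (Fin n × Fin n) → Set P

namespace LearningAlgorithm

attribute [instance] measurableSpaceSeed isProbabilityMeasure_seedLaw

variable {n : ℕ} {P : Type}

/-- The joint law of the seed and of the observations when the instance is `z`. -/
noncomputable def law (alg : LearningAlgorithm n P) (z : Profile n) :
    Measure (alg.Seed × (ℕ → Fin n × Fin n)) :=
  alg.seedLaw.prod (sampleLaw z)

/-- The number `τ` of observations at which the algorithm stops (`⊤` if it never does). -/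
noncomputable def stoppingTime (alg : LearningAlgorithm n P)
    (p : alg.Seed × (ℕ → Fin n × Fin n)) : ℕ∞ :=
  ⨅ (t : ℕ) (_ : alg.stopsAt p.1 (history p.2 t)), (t : ℕ∞)

/-- The expected sample complexity `E_{x,y}[τ]`, possibly infinite. -/
noncomputable def expectedSamples (alg : LearningAlgorithm n P) (z : Profile n) : ℝ≥0∞ :=
  ∫⁻ p, (alg.stoppingTime p : ℝ≥0∞) ∂(alg.law z)

/-- The event that the algorithm stops and returns a set at Hausdorff distance at least `ε` from
`T`. The distance is extended-valued: an empty recommendation is at distance `∞` from a nonempty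
`T`. -/
def failureEvent [PseudoEMetricSpace P] (alg : LearningAlgorithm n P) (T : Set P) (ε : ℝ) :
    Set (alg.Seed × (ℕ → Fin n × Fin n)) :=
  {p | ∃ t : ℕ, alg.stoppingTime p = (t : ℕ∞) ∧
    ENNReal.ofReal ε ≤ Metric.hausdorffEDist T (alg.recommend p.1 (history p.2 t))}

/-- `(ε, δ)`-correctness for learning the set-valued map `feasible`: for every instance, the
probability that the returned set is at Hausdorff distance at least `ε` from the feasible set is
at most `δ`. Termination is not required; algorithms that stop almost surely under every instance
are a special case. -/
def IsCorrect [PseudoEMetricSpace P] (alg : LearningAlgorithm n P)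
    (feasible : Profile n → Set P) (ε δ : ℝ) : Prop :=
  ∀ z : Profile n, MeasurableSet (alg.failureEvent (feasible z) ε) ∧
    alg.law z (alg.failureEvent (feasible z) ε) ≤ ENNReal.ofReal δ

end LearningAlgorithm

/-! The hard instances let the second player always play action `0`. The first player plays a safe
action `0` except with probability of order `α`, which is spread over the other actions with weights
`w i`. If action `i + 1` costs `b i ≥ 0` more than the safe one, the regret of the first player is
`∑ w i * b i`, and the game is feasible exactly when this is at most `α`. A relative change of order
`ε` in the weights therefore moves the boundary of the feasible set by order `ε`. The changed mass
has order `α`, so one observation has χ²-divergence only `O(ε²α)` between such instances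
(`secondMoment_safeActionProfile_le`).

Events decided by `N` observations change measure by Cauchy–Schwarz (`law_real_sq_le`), at the price
`(1 + χ²)^N`. Two families of weights turn this into sample bounds. Scaling all weights together by
`1 + 16εk`, `k ≤ 8`, gives nine pairwise separated instances and the `log (1/δ)` bound
(`IsCorrect.log_div_le_expectedSamples`). Perturbing each weight by a sign gives a hypercube in
which instances at Hamming distance at least `d / 4` are separated. One recommendation then fits
only an exponentially small fraction of the cube, and a Fano-type average gives the bound linear in
`n` (`IsCorrect.sub_div_le_average_expectedSamples`). The prior `ν` mixes the base instance and the
cube equally, so both bounds add up. -/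

/-! ### Probabilities of events with a finite horizon -/

theorem strategyPMF_real_singleton {n : ℕ} (x : stdSimplex ℝ (Fin n)) (i : Fin n) :
    (strategyPMF x).toMeasure.real {i} = x.1 i := by
  rw [measureReal_def, PMF.toMeasure_apply_singleton _ _ (MeasurableSet.singleton _)]
  simp [strategyPMF, ENNReal.toReal_ofReal (x.2.1 i)]

theorem roundLaw_real_singleton {n : ℕ} (z : Profile n) (a : Fin n × Fin n) :
    (roundLaw z).real {a} = z.1.1 a.1 * z.2.1 a.2 := by
  rw [← strategyPMF_real_singleton z.1, ← strategyPMF_real_singleton z.2, roundLaw,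
    ← measureReal_prod_prod, Set.singleton_prod_singleton]

instance {n : ℕ} (z : Profile n) : IsProbabilityMeasure (sampleLaw z) := by
  unfold sampleLaw
  infer_instance

theorem measurableSet_apply_eq {n : ℕ} (t : ℕ) (a : Fin n × Fin n) :
    MeasurableSet {ω : ℕ → Fin n × Fin n | ω t = a} := by
  have h := measurable_pi_apply (X := fun _ : ℕ => Fin n × Fin n) t (MeasurableSet.singleton a)
  convert h using 1
  ext ω
  simp

theorem sampleLaw_real_cylinder {n : ℕ} (z : Profile n) (N : ℕ) (h : Fin N → Fin n × Fin n) :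
    (sampleLaw z).real {ω | ∀ i : Fin N, ω i = h i} = ∏ i, (roundLaw z).real {h i} := by
  have hset : {ω : ℕ → Fin n × Fin n | ∀ i : Fin N, ω i = h i}
      = Set.pi (Finset.range N : Set ℕ)
        (fun t => if ht : t < N then {h ⟨t, ht⟩} else Set.univ) := by
    ext ω
    simp only [Set.mem_ofPred_eq, Set.mem_pi, Finset.coe_range, Set.mem_Iio]
    constructor
    · intro H t ht
      simpa [ht] using H ⟨t, ht⟩
    · intro H i
      simpa using H i i.2
  rw [hset, measureReal_def, sampleLaw, Measure.infinitePi_pi]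
  · rw [Finset.prod_range, ENNReal.toReal_prod]
    simp [measureReal_def]
  · intro i _
    exact (Set.toFinite _).measurableSet

/-- The set `S` of runs is determined by the seed and the first `N` observations. -/
def DeterminedBy {n : ℕ} {U : Type} (N : ℕ) (S : Set (U × (ℕ → Fin n × Fin n))) : Prop :=
  ∀ u ω ω', (∀ t < N, ω t = ω' t) → (u, ω) ∈ S → (u, ω') ∈ S

/-- The sequence starting with `h` and continuing with a fixed action pair. -/
def extendHistory {X : Type} {N : ℕ} (a : X) (h : Fin N → X) (t : ℕ) : X :=
  if ht : t < N then h ⟨t, ht⟩ else a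

namespace LearningAlgorithm

variable {n : ℕ} {P : Type}

instance (alg : LearningAlgorithm n P) (z : Profile n) : IsProbabilityMeasure (alg.law z) := by
  unfold law
  infer_instance

/-- Such an event is a finite disjoint union of rectangles, a set of seeds times a cylinder, and
seed and data are independent. The pair `a` only fills the irrelevant tail of the sequence. -/
theorem law_real_eq_sum (alg : LearningAlgorithm n P) (z : Profile n) (a : Fin n × Fin n)
    {N : ℕ} {S : Set (alg.Seed × (ℕ → Fin n × Fin n))} (hS : MeasurableSet S)
    (hN : DeterminedBy N S) :
    (alg.law z).real S = ∑ h : Fin N → Fin n × Fin n,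
      alg.seedLaw.real {u | (u, extendHistory a h) ∈ S} * ∏ i, (roundLaw z).real {h i} := by
  have hcyl : ∀ h : Fin N → Fin n × Fin n,
      MeasurableSet {ω : ℕ → Fin n × Fin n | ∀ i : Fin N, ω i = h i} := by
    intro h
    rw [Set.ofPred_forall]
    exact MeasurableSet.iInter fun i =>
      measurableSet_apply_eq i (h i)
  have hsec : ∀ h : Fin N → Fin n × Fin n,
      MeasurableSet {u | (u, extendHistory a h) ∈ S} := fun h =>
    measurable_prodMk_right hS
  have hunion : S = ⋃ h ∈ (Finset.univ : Finset (Fin N → Fin n × Fin n)),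
      {u | (u, extendHistory a h) ∈ S} ×ˢ {ω : ℕ → Fin n × Fin n | ∀ i : Fin N, ω i = h i} := by
    ext ⟨u, ω⟩
    simp only [Finset.mem_univ, Set.iUnion_true, Set.mem_iUnion, Set.mem_prod, Set.mem_ofPred_eq]
    constructor
    · intro hu
      refine ⟨fun i => ω i, hN u ω _ ?_ hu, fun i => rfl⟩
      intro t ht
      simp [extendHistory, ht]
    · rintro ⟨h, hu, hω⟩
      refine hN u _ ω ?_ hu
      intro t ht
      simp [extendHistory, ht, ← hω ⟨t, ht⟩]
  conv_lhs => rw [hunion]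
  rw [measureReal_biUnion_finset]
  · refine Finset.sum_congr rfl fun h _ => ?_
    rw [law, measureReal_prod_prod, sampleLaw_real_cylinder]
  · intro h _ h' _ hne
    refine Set.disjoint_left.2 ?_
    rintro ⟨u, ω⟩ ⟨_, h1⟩ ⟨_, h2⟩
    exact hne (funext fun i => (h1 i).symm.trans (h2 i))
  · intro h _
    exact (hsec h).prod (hcyl h)

end LearningAlgorithm

/-! ### Change of measure -/

/-- The second moment `∑ₐ p(a)² / q(a)` of the likelihood ratio of one round, i.e. `1 + χ²`. -/
noncomputable def secondMoment {n : ℕ} (z z' : Profile n) : ℝ :=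
  ∑ a, (roundLaw z).real {a} ^ 2 / (roundLaw z').real {a}

namespace LearningAlgorithm

variable {n : ℕ} {P : Type}

/-- Cauchy–Schwarz between the likelihood under `z'` and the squared likelihood ratio, which
factorises over rounds. Unlike a bound on total variation, it stays informative when the probability
under `z'` is as small as `δ`. -/
theorem law_real_sq_le (alg : LearningAlgorithm n P) (z z' : Profile n)
    (hac : ∀ a, (roundLaw z').real {a} = 0 → (roundLaw z).real {a} = 0)
    (a : Fin n × Fin n) {N : ℕ} {S : Set (alg.Seed × (ℕ → Fin n × Fin n))}
    (hS : MeasurableSet S) (hN : DeterminedBy N S) :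
    (alg.law z).real S ^ 2 ≤ (alg.law z').real S * secondMoment z z' ^ N := by
  rw [alg.law_real_eq_sum z a hS hN, alg.law_real_eq_sum z' a hS hN]
  set m : (Fin N → Fin n × Fin n) → ℝ :=
    fun h => alg.seedLaw.real {u | (u, extendHistory a h) ∈ S}
  have hm0 : ∀ h, 0 ≤ m h := fun h => measureReal_nonneg
  have hm1 : ∀ h, m h ≤ 1 := fun h => measureReal_le_one
  calc (∑ h, m h * ∏ i, (roundLaw z).real {h i}) ^ 2
      ≤ (∑ h, m h * ∏ i, (roundLaw z').real {h i}) *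
        ∑ h, m h * ∏ i, ((roundLaw z).real {h i} ^ 2 / (roundLaw z').real {h i}) := by
        refine Finset.sum_sq_le_sum_mul_sum_of_sq_le_mul _ (fun h _ => ?_) (fun h _ => ?_)
          fun h _ => ?_
        · exact mul_nonneg (hm0 h) (Finset.prod_nonneg fun i _ => measureReal_nonneg)
        · exact mul_nonneg (hm0 h) (Finset.prod_nonneg fun i _ =>
            div_nonneg (sq_nonneg _) measureReal_nonneg)
        · refine le_of_eq ?_
          rw [mul_mul_mul_comm, ← Finset.prod_mul_distrib, mul_pow, ← Finset.prod_pow, sq (m h)]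
          congr 1
          refine Finset.prod_congr rfl fun i _ => ?_
          -- Division by zero yields `0`, so absolute continuity is what keeps the identity true on
          -- null outcomes of `z'`.
          by_cases h0 : (roundLaw z').real {h i} = 0
          · simp [h0, hac _ h0]
          · field_simp
    _ ≤ (∑ h, m h * ∏ i, (roundLaw z').real {h i}) *
        ∑ h : Fin N → Fin n × Fin n,
          ∏ i, ((roundLaw z).real {h i} ^ 2 / (roundLaw z').real {h i}) := by
        refine mul_le_mul_of_nonneg_left (Finset.sum_le_sum fun h _ => ?_)
          (Finset.sum_nonneg fun h _ =>
            mul_nonneg (hm0 h) (Finset.prod_nonneg fun i _ => measureReal_nonneg))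
        exact mul_le_of_le_one_left (Finset.prod_nonneg fun i _ =>
            div_nonneg (sq_nonneg _) measureReal_nonneg) (hm1 h)
    _ = _ := by
        congr 1
        rw [secondMoment, ← Fin.prod_const, Finset.prod_univ_sum, Fintype.piFinset_univ]

/-! ### Stopping times, early failure and early success -/

theorem stoppingTime_eq_coe_iff (alg : LearningAlgorithm n P)
    (p : alg.Seed × (ℕ → Fin n × Fin n)) (t : ℕ) :
    alg.stoppingTime p = t ↔
      alg.stopsAt p.1 (history p.2 t) ∧ ∀ s < t, ¬ alg.stopsAt p.1 (history p.2 s) := by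
  constructor
  · intro h
    have hlow : ∀ s < t, ¬ alg.stopsAt p.1 (history p.2 s) := by
      intro s hs hlate
      have : alg.stoppingTime p ≤ s := iInf₂_le s hlate
      rw [h] at this
      exact absurd (by exact_mod_cast this) (not_le.2 hs)
    refine ⟨?_, hlow⟩
    by_contra hn
    have : ((t + 1 : ℕ) : ℕ∞) ≤ alg.stoppingTime p := by
      refine le_iInf₂ fun s hs => ?_
      rw [Nat.cast_le]
      by_contra hlt
      rcases (Nat.lt_succ_iff.1 (not_le.1 hlt)).lt_or_eq with h1 | h1
      · exact hlow s h1 hs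
      · exact hn (h1 ▸ hs)
    rw [h, Nat.cast_le] at this
    omega
  · rintro ⟨h1, h2⟩
    refine le_antisymm (iInf₂_le t h1) (le_iInf₂ fun s hs => ?_)
    rw [Nat.cast_le]
    by_contra hlt
    exact h2 s (not_le.1 hlt) hs

theorem stoppingTime_le_coe_iff (alg : LearningAlgorithm n P)
    (p : alg.Seed × (ℕ → Fin n × Fin n)) (N : ℕ) :
    alg.stoppingTime p ≤ N ↔ ∃ t ≤ N, alg.stoppingTime p = t := by
  constructor
  · intro h
    obtain ⟨t, ht⟩ := ENat.ne_top_iff_exists.1 (ne_top_of_le_ne_top (ENat.natCast_ne_top N) h)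
    exact ⟨t, by rw [← ht] at h; exact_mod_cast h, ht.symm⟩
  · rintro ⟨t, ht, h⟩
    rw [h]
    exact_mod_cast ht

theorem history_congr {ω ω' : ℕ → Fin n × Fin n} {N t : ℕ} (h : ∀ s < N, ω s = ω' s)
    (ht : t ≤ N) : history ω t = history ω' t :=
  List.map_congr_left fun s hs => h s (lt_of_lt_of_le (List.mem_range.1 hs) ht)

theorem stoppingTime_congr (alg : LearningAlgorithm n P) {u : alg.Seed}
    {ω ω' : ℕ → Fin n × Fin n} {N t : ℕ} (h : ∀ s < N, ω s = ω' s) (ht : t ≤ N)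
    (hτ : alg.stoppingTime (u, ω) = t) : alg.stoppingTime (u, ω') = t := by
  rw [stoppingTime_eq_coe_iff] at hτ ⊢
  dsimp only at hτ ⊢
  refine ⟨history_congr h ht ▸ hτ.1, fun s hs => ?_⟩
  rw [← history_congr h (hs.le.trans ht)]
  exact hτ.2 s hs

theorem measurableSet_history_eq (t : ℕ) (l : List (Fin n × Fin n)) :
    MeasurableSet {ω : ℕ → Fin n × Fin n | history ω t = l} := by
  induction t generalizing l with
  | zero => simp [history]
  | succ t ih =>
    have : {ω : ℕ → Fin n × Fin n | history ω (t + 1) = l} =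
        ⋃ (l' : List (Fin n × Fin n)) (a : Fin n × Fin n) (_ : l' ++ [a] = l),
          {ω | history ω t = l'} ∩ {ω | ω t = a} := by
      ext ω
      simp [history, List.range_succ]
    rw [this]
    exact MeasurableSet.iUnion fun l' => MeasurableSet.iUnion fun a => MeasurableSet.iUnion fun _ =>
      (ih l').inter (measurableSet_apply_eq t a)

theorem measurableSet_stopsAt_history (alg : LearningAlgorithm n P) (t : ℕ) :
    MeasurableSet {p : alg.Seed × (ℕ → Fin n × Fin n) | alg.stopsAt p.1 (history p.2 t)} := by
  have : {p : alg.Seed × (ℕ → Fin n × Fin n) | alg.stopsAt p.1 (history p.2 t)} =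
      ⋃ l : List (Fin n × Fin n), {u | alg.stopsAt u l} ×ˢ {ω | history ω t = l} := by
    ext p
    simp
  rw [this]
  exact MeasurableSet.iUnion fun l =>
    (alg.measurableSet_stopsAt l).prod (measurableSet_history_eq t l)

theorem measurableSet_stoppingTime_le (alg : LearningAlgorithm n P) (N : ℕ) :
    MeasurableSet {p | alg.stoppingTime p ≤ N} := by
  have : {p | alg.stoppingTime p ≤ N} =
      ⋃ (t : ℕ) (_ : t ≤ N), {p | alg.stopsAt p.1 (history p.2 t)} := by
    ext p
    simp only [Set.mem_ofPred_eq, Set.mem_iUnion, exists_prop]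
    constructor
    · rw [stoppingTime_le_coe_iff]
      rintro ⟨t, ht, h⟩
      exact ⟨t, ht, ((alg.stoppingTime_eq_coe_iff p t).1 h).1⟩
    · rintro ⟨t, ht, h⟩
      exact (iInf₂_le t h).trans (by exact_mod_cast ht)
  rw [this]
  exact MeasurableSet.iUnion fun t => MeasurableSet.iUnion fun _ =>
    alg.measurableSet_stopsAt_history t

/-- Markov's inequality for the number of samples. -/
theorem mul_law_stoppingTime_gt_le (alg : LearningAlgorithm n P) (z : Profile n) (N : ℕ) :
    (N + 1 : ℝ≥0∞) * alg.law z {p | alg.stoppingTime p ≤ N}ᶜ ≤ alg.expectedSamples z := by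
  rw [← lintegral_indicator_const (alg.measurableSet_stoppingTime_le N).compl, expectedSamples]
  refine lintegral_mono fun p => ?_
  by_cases hp : alg.stoppingTime p ≤ N
  · simp [hp]
  · have h1 : ((N + 1 : ℕ) : ℕ∞) ≤ alg.stoppingTime p := by
      rw [Nat.cast_add, Nat.cast_one]
      exact Order.add_one_le_of_lt (not_le.1 hp)
    have h2 : (((N + 1 : ℕ) : ℕ∞) : ℝ≥0∞) ≤ (alg.stoppingTime p : ℝ≥0∞) :=
      ENat.toENNReal_le.2 h1
    simpa [hp] using h2

theorem law_real_stoppingTime_gt_le (alg : LearningAlgorithm n P) (z : Profile n) (N : ℕ)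
    (hE : alg.expectedSamples z ≠ ⊤) :
    (N + 1 : ℝ) * (alg.law z).real {p | alg.stoppingTime p ≤ N}ᶜ ≤
      (alg.expectedSamples z).toReal := by
  have h := ENNReal.toReal_mono hE (alg.mul_law_stoppingTime_gt_le z N)
  rw [ENNReal.toReal_mul] at h
  have h1 : (N + 1 : ℝ≥0∞).toReal = N + 1 := by
    rw [ENNReal.toReal_add (by simp) (by simp)]
    simp
  rwa [h1] at h

/-- The algorithm stops within `N` samples and its recommendation is `ε`-far from `T`. -/
def earlyFailure [PseudoEMetricSpace P] (alg : LearningAlgorithm n P) (T : Set P) (ε : ℝ)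
    (N : ℕ) : Set (alg.Seed × (ℕ → Fin n × Fin n)) :=
  {p | alg.stoppingTime p ≤ N} ∩ alg.failureEvent T ε

/-- The algorithm stops within `N` samples and its recommendation is `ε`-close to `T`. -/
def earlySuccess [PseudoEMetricSpace P] (alg : LearningAlgorithm n P) (T : Set P) (ε : ℝ)
    (N : ℕ) : Set (alg.Seed × (ℕ → Fin n × Fin n)) :=
  {p | alg.stoppingTime p ≤ N} \ alg.failureEvent T ε

theorem mem_earlyFailure_iff [PseudoEMetricSpace P] (alg : LearningAlgorithm n P) (T : Set P)
    (ε : ℝ) (N : ℕ) (p : alg.Seed × (ℕ → Fin n × Fin n)) :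
    p ∈ alg.earlyFailure T ε N ↔ ∃ t ≤ N, alg.stoppingTime p = t ∧
      ENNReal.ofReal ε ≤ Metric.hausdorffEDist T (alg.recommend p.1 (history p.2 t)) := by
  simp only [earlyFailure, failureEvent, Set.mem_inter_iff, Set.mem_ofPred_eq]
  constructor
  · rintro ⟨h, t, ht, hd⟩
    exact ⟨t, by rw [ht] at h; exact_mod_cast h, ht, hd⟩
  · rintro ⟨t, h, ht, hd⟩
    exact ⟨by rw [ht]; exact_mod_cast h, t, ht, hd⟩

theorem mem_earlySuccess_iff [PseudoEMetricSpace P] (alg : LearningAlgorithm n P) (T : Set P)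
    (ε : ℝ) (N : ℕ) (p : alg.Seed × (ℕ → Fin n × Fin n)) :
    p ∈ alg.earlySuccess T ε N ↔ ∃ t ≤ N, alg.stoppingTime p = t ∧
      Metric.hausdorffEDist T (alg.recommend p.1 (history p.2 t)) < ENNReal.ofReal ε := by
  simp only [earlySuccess, failureEvent, Set.mem_sdiff, Set.mem_ofPred_eq]
  constructor
  · rintro ⟨h, hf⟩
    obtain ⟨t, ht, h1⟩ := (alg.stoppingTime_le_coe_iff p N).1 h
    exact ⟨t, ht, h1, not_le.1 fun h2 => hf ⟨t, h1, h2⟩⟩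
  · rintro ⟨t, h, ht, hd⟩
    refine ⟨by rw [ht]; exact_mod_cast h, ?_⟩
    rintro ⟨s, hs, hd'⟩
    rw [ht] at hs
    obtain rfl : t = s := by exact_mod_cast hs
    exact absurd hd' (not_le.2 hd)

theorem determinedBy_earlyFailure [PseudoEMetricSpace P] (alg : LearningAlgorithm n P)
    (T : Set P) (ε : ℝ) (N : ℕ) : DeterminedBy N (alg.earlyFailure T ε N) := by
  intro u ω ω' h hp
  rw [mem_earlyFailure_iff] at hp ⊢
  obtain ⟨t, ht, h1, h2⟩ := hp
  exact ⟨t, ht, alg.stoppingTime_congr h ht h1, by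
    dsimp only at h2 ⊢; rwa [← history_congr h ht]⟩

theorem determinedBy_earlySuccess [PseudoEMetricSpace P] (alg : LearningAlgorithm n P)
    (T : Set P) (ε : ℝ) (N : ℕ) : DeterminedBy N (alg.earlySuccess T ε N) := by
  intro u ω ω' h hp
  rw [mem_earlySuccess_iff] at hp ⊢
  obtain ⟨t, ht, h1, h2⟩ := hp
  exact ⟨t, ht, alg.stoppingTime_congr h ht h1, by
    dsimp only at h2 ⊢; rwa [← history_congr h ht]⟩

end LearningAlgorithm

/-! ### Sample bounds from separated instances -/

/-- If every point lies in at most `V` of the sets `S i`, their measures add up to at most `V`. -/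
theorem sum_measureReal_le_of_card_le {Ω I : Type*} [MeasurableSpace Ω] [Fintype I]
    (μ : Measure Ω) [IsProbabilityMeasure μ] (S : I → Set Ω) (hS : ∀ i, MeasurableSet (S i))
    (V : ℝ) (hV : ∀ p, ∀ F : Finset I, (∀ i ∈ F, p ∈ S i) → (F.card : ℝ) ≤ V) :
    ∑ i, μ.real (S i) ≤ V := by
  classical
  have hint : ∀ i, Integrable ((S i).indicator (1 : Ω → ℝ)) μ := fun i =>
    (integrable_const (1 : ℝ)).indicator (hS i)
  calc ∑ i, μ.real (S i) = ∫ p, ∑ i, (S i).indicator (1 : Ω → ℝ) p ∂μ := by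
        rw [integral_finsetSum _ fun i _ => hint i]
        exact Finset.sum_congr rfl fun i _ => (integral_indicator_one (hS i)).symm
    _ ≤ ∫ _, V ∂μ := by
        refine integral_mono (integrable_finsetSum _ fun i _ => hint i) (integrable_const V)
          fun p => ?_
        have h := hV p (Finset.univ.filter fun i => p ∈ S i) (by simp)
        simpa [Set.indicator_apply, Finset.sum_ite] using h
    _ = V := by simp

theorem one_add_pow_le_exp_mul {χ : ℝ} (hχ : 0 ≤ 1 + χ) (N : ℕ) :
    (1 + χ) ^ N ≤ Real.exp (N * χ) := by
  rw [Real.exp_nat_mul]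
  exact pow_le_pow_left₀ hχ (by linarith [Real.add_one_le_exp χ]) N

theorem secondMoment_nonneg {n : ℕ} (z z' : Profile n) : 0 ≤ secondMoment z z' :=
  Finset.sum_nonneg fun _ _ => div_nonneg (sq_nonneg _) measureReal_nonneg

namespace LearningAlgorithm

variable {n : ℕ} {P : Type} [PseudoEMetricSpace P]

theorem IsCorrect.law_real_earlyFailure_le {alg : LearningAlgorithm n P}
    {T : Profile n → Set P} {ε δ : ℝ} (hc : alg.IsCorrect T ε δ) (hδ : 0 ≤ δ) (z : Profile n)
    (N : ℕ) : (alg.law z).real (alg.earlyFailure (T z) ε N) ≤ δ :=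
  (measureReal_mono Set.inter_subset_right).trans (ENNReal.toReal_le_of_le_ofReal hδ (hc z).2)

theorem IsCorrect.measurableSet_earlyFailure {alg : LearningAlgorithm n P}
    {T : Profile n → Set P} {ε δ : ℝ} (hc : alg.IsCorrect T ε δ) (z : Profile n) (N : ℕ) :
    MeasurableSet (alg.earlyFailure (T z) ε N) :=
  (alg.measurableSet_stoppingTime_le N).inter (hc z).1

/-- Recommendations carry no measurability of their own; early success inherits it as the complement
of the failure event within the runs that stop early. -/
theorem IsCorrect.measurableSet_earlySuccess {alg : LearningAlgorithm n P}
    {T : Profile n → Set P} {ε δ : ℝ} (hc : alg.IsCorrect T ε δ) (z : Profile n) (N : ℕ) :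
    MeasurableSet (alg.earlySuccess (T z) ε N) :=
  (alg.measurableSet_stoppingTime_le N).diff (hc z).1

theorem one_sub_le_failure_add_success (alg : LearningAlgorithm n P) (z : Profile n) (T : Set P)
    (ε : ℝ) (N : ℕ) :
    1 - (alg.law z).real {p | alg.stoppingTime p ≤ N}ᶜ ≤
      (alg.law z).real (alg.earlyFailure T ε N) + (alg.law z).real (alg.earlySuccess T ε N) := by
  rw [probReal_compl_eq_one_sub (alg.measurableSet_stoppingTime_le N), sub_sub_cancel]
  have h : {p | alg.stoppingTime p ≤ N} = alg.earlyFailure T ε N ∪ alg.earlySuccess T ε N :=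
    (Set.inter_union_sdiff _ _).symm
  rw [h]
  exact measureReal_union_le _ _

/-- The same recommendation cannot be close to two sets that are far from each other. -/
theorem notMem_earlySuccess_of_separated (alg : LearningAlgorithm n P) {T T' : Set P} {ε : ℝ}
    (hε : 0 ≤ ε) {N : ℕ} (hsep : ENNReal.ofReal (2 * ε) ≤ Metric.hausdorffEDist T T')
    {p : alg.Seed × (ℕ → Fin n × Fin n)} (hp : p ∈ alg.earlySuccess T ε N) :
    p ∉ alg.earlySuccess T' ε N := by
  rw [mem_earlySuccess_iff] at hp ⊢
  rintro ⟨s, _, hs, hd'⟩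
  obtain ⟨t, _, ht, hd⟩ := hp
  rw [ht] at hs
  obtain rfl : t = s := by exact_mod_cast hs
  rw [Metric.hausdorffEDist_comm] at hd'
  refine absurd hsep (not_le.2 ?_)
  rw [two_mul, ENNReal.ofReal_add hε hε]
  exact Metric.hausdorffEDist_triangle.trans_lt (ENNReal.add_lt_add hd hd')

/-- A lower bound on the number of samples used under `z₀`, from eight alternatives. -/
theorem IsCorrect.log_div_le_expectedSamples {alg : LearningAlgorithm n P}
    {T : Profile n → Set P} {ε δ χ : ℝ} (hc : alg.IsCorrect T ε δ) (hε : 0 ≤ ε) (hδ : 0 < δ)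
    (hδ' : δ ≤ 1 / 2) (hχ : 0 < χ) (a : Fin n × Fin n) (z₀ : Profile n) (z : Fin 8 → Profile n)
    (hsep₀ : ∀ k, ENNReal.ofReal (2 * ε) ≤ Metric.hausdorffEDist (T z₀) (T (z k)))
    (hsep : ∀ j k, j ≠ k →
      ENNReal.ofReal (2 * ε) ≤ Metric.hausdorffEDist (T (z j)) (T (z k)))
    (hac : ∀ k a, (roundLaw (z k)).real {a} = 0 → (roundLaw z₀).real {a} = 0)
    (hmom : ∀ k, secondMoment z₀ (z k) ≤ 1 + χ) :
    ENNReal.ofReal (Real.log (1 / δ) / (32 * χ)) ≤ alg.expectedSamples z₀ := by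
  by_cases hE : alg.expectedSamples z₀ = ⊤
  · simp [hE]
  set E := (alg.expectedSamples z₀).toReal with hEdef
  have hE0 : 0 ≤ E := ENNReal.toReal_nonneg
  -- By Markov the run exceeds `N` samples with probability at most `E / (N + 1) ≤ 1 / 16`.
  set N := ⌊16 * E⌋₊
  have hN : (N : ℝ) ≤ 16 * E := Nat.floor_le (by positivity)
  have hN' : 16 * E < N + 1 := Nat.lt_floor_add_one _
  have hlate : (alg.law z₀).real {p | alg.stoppingTime p ≤ N}ᶜ ≤ 1 / 16 := by
    have h := alg.law_real_stoppingTime_gt_le z₀ N hE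
    have h0 : 0 ≤ (alg.law z₀).real {p | alg.stoppingTime p ≤ N}ᶜ := measureReal_nonneg
    by_contra hlt
    rw [← hEdef] at h
    nlinarith [not_le.1 hlt]
  -- The eight success events are disjoint and all are failures for `z₀`, so their total is at most
  -- `δ ≤ 1 / 2 = 8 / 16`. A single alternative would not suffice for `δ` near `1 / 2`.
  obtain ⟨k, hk⟩ : ∃ k, (alg.law z₀).real (alg.earlySuccess (T (z k)) ε N) ≤ 1 / 16 := by
    by_contra! hall
    have hdisj : ∑ k, (alg.law z₀).real (alg.earlySuccess (T (z k)) ε N) =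
        (alg.law z₀).real (⋃ k, alg.earlySuccess (T (z k)) ε N) := by
      rw [measureReal_iUnion_fintype]
      · intro j k hjk
        exact Set.disjoint_left.2 fun p hp =>
          alg.notMem_earlySuccess_of_separated hε (hsep j k hjk) hp
      · exact fun k => hc.measurableSet_earlySuccess (z k) N
    have hsub : (⋃ k, alg.earlySuccess (T (z k)) ε N) ⊆ alg.earlyFailure (T z₀) ε N := by
      refine Set.iUnion_subset fun k p hp => ⟨hp.1, ?_⟩
      by_contra hnot
      exact alg.notMem_earlySuccess_of_separated hε (hsep₀ k) ⟨hp.1, hnot⟩ hp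
    have h1 := (measureReal_mono (μ := alg.law z₀) hsub).trans
      (hc.law_real_earlyFailure_le hδ.le z₀ N)
    rw [← hdisj] at h1
    have h2 : ∑ _k : Fin 8, (1 / 16 : ℝ) <
        ∑ k, (alg.law z₀).real (alg.earlySuccess (T (z k)) ε N) :=
      Finset.sum_lt_sum_of_nonempty Finset.univ_nonempty fun k _ => hall k
    simp only [Finset.sum_const, Finset.card_univ, Fintype.card_fin, nsmul_eq_mul] at h2
    norm_num at h2
    linarith
  have hfail : 7 / 8 ≤ (alg.law z₀).real (alg.earlyFailure (T (z k)) ε N) := by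
    linarith [alg.one_sub_le_failure_add_success z₀ (T (z k)) ε N]
  have hcs := alg.law_real_sq_le z₀ (z k) (hac k) a (hc.measurableSet_earlyFailure (z k) N)
    (alg.determinedBy_earlyFailure (T (z k)) ε N)
  have hpow : secondMoment z₀ (z k) ^ N ≤ Real.exp (N * χ) :=
    (pow_le_pow_left₀ (secondMoment_nonneg _ _) (hmom k) N).trans
      (one_add_pow_le_exp_mul (by linarith) N)
  have hmain : (7 / 8 : ℝ) ^ 2 ≤ δ * Real.exp (N * χ) := by
    refine (pow_le_pow_left₀ (by norm_num) hfail 2).trans (hcs.trans ?_)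
    exact mul_le_mul (hc.law_real_earlyFailure_le hδ.le (z k) N) hpow
      (pow_nonneg (secondMoment_nonneg _ _) N) hδ.le
  have hlog := Real.log_le_log (by norm_num) hmain
  rw [Real.log_mul hδ.ne' (Real.exp_ne_zero _), Real.log_exp, Real.log_pow] at hlog
  -- The constant lost, `2 * log (8 / 7)`, is at most half of `log 2 ≤ log (1 / δ)`, so half of `log
  -- (1 / δ)` survives.
  have hlog2 : -Real.log 2 ≤ 4 * Real.log (7 / 8) := by
    have h : Real.log 1 ≤ Real.log ((7 / 8) ^ 4 * 2) :=
      Real.log_le_log (by norm_num) (by norm_num)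
    rw [Real.log_mul (by norm_num) (by norm_num), Real.log_pow, Real.log_one] at h
    push_cast at h
    linarith
  have hδlog : Real.log δ ≤ -Real.log 2 := by
    have h := Real.log_le_log hδ hδ'
    rwa [one_div, Real.log_inv] at h
  push_cast at hlog
  refine ENNReal.ofReal_le_of_le_toReal ?_
  rw [← hEdef, one_div, Real.log_inv, div_le_iff₀ (by positivity)]
  nlinarith

/-- A lower bound on the average number of samples over a family of instances of which any
recommendation fits only few. -/
theorem IsCorrect.sub_div_le_average_expectedSamples {alg : LearningAlgorithm n P}
    {T : Profile n → Set P} {ε δ χ β V : ℝ} (hc : alg.IsCorrect T ε δ) (hδ : 0 < δ)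
    (hδ' : δ ≤ 1 / 2) (hχ : 0 < χ) (a : Fin n × Fin n) {I : Type} [Fintype I] [Nonempty I]
    (z₀ : Profile n) (z : I → Profile n)
    (hV : ∀ (R : Set P) (F : Finset I),
      (∀ i ∈ F, Metric.hausdorffEDist (T (z i)) R < ENNReal.ofReal ε) → (F.card : ℝ) ≤ V)
    (hVβ : V ≤ Real.exp (-β) * Fintype.card I)
    (hac : ∀ i a, (roundLaw z₀).real {a} = 0 → (roundLaw (z i)).real {a} = 0)
    (hmom : ∀ i, secondMoment (z i) z₀ ≤ 1 + χ) :
    ENNReal.ofReal ((β - Real.log 16) / (4 * χ)) ≤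
      (Fintype.card I : ℝ≥0∞)⁻¹ * ∑ i, alg.expectedSamples (z i) := by
  set M : ℝ := ((Fintype.card I : ℕ) : ℝ) with hM
  have hM0 : 0 < M := by rw [hM]; exact_mod_cast Fintype.card_pos
  by_cases hE : ∑ i, alg.expectedSamples (z i) = ⊤
  · rw [hE, ENNReal.mul_top (by simp)]
    exact le_top
  have hEi : ∀ i, alg.expectedSamples (z i) ≠ ⊤ := fun i =>
    ne_top_of_le_ne_top hE (Finset.single_le_sum (f := fun i => alg.expectedSamples (z i))
      (fun _ _ => zero_le) (Finset.mem_univ i))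
  set E := ((Fintype.card I : ℝ≥0∞)⁻¹ * ∑ i, alg.expectedSamples (z i)).toReal with hEdef
  have hEsum : ∑ i, (alg.expectedSamples (z i)).toReal = M * E := by
    rw [hEdef, ENNReal.toReal_mul, ENNReal.toReal_sum fun i _ => hEi i, ENNReal.toReal_inv,
      ENNReal.toReal_natCast, ← hM, mul_inv_cancel_left₀ hM0.ne']
  have hE0 : 0 ≤ E := ENNReal.toReal_nonneg
  -- Early success has probability at least `1 - δ - 1 / 4 ≥ 1 / 4` on average over the family.
  set N := ⌊4 * E⌋₊
  have hN : (N : ℝ) ≤ 4 * E := Nat.floor_le (by positivity)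
  have hN' : 4 * E < N + 1 := Nat.lt_floor_add_one _
  have hN0 : (0 : ℝ) < N + 1 := by positivity
  have hsucc : M / 4 ≤ ∑ i, (alg.law (z i)).real (alg.earlySuccess (T (z i)) ε N) := by
    have h1 : ∀ i, 1 / 2 - (alg.expectedSamples (z i)).toReal / (N + 1) ≤
        (alg.law (z i)).real (alg.earlySuccess (T (z i)) ε N) := by
      intro i
      have h2 := alg.law_real_stoppingTime_gt_le (z i) N (hEi i)
      rw [mul_comm, ← le_div_iff₀ hN0] at h2
      linarith [alg.one_sub_le_failure_add_success (z i) (T (z i)) ε N,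
        hc.law_real_earlyFailure_le hδ.le (z i) N]
    refine le_trans ?_ (Finset.sum_le_sum fun i _ => h1 i)
    rw [Finset.sum_sub_distrib, Finset.sum_const, Finset.card_univ,
      nsmul_eq_mul, ← hM, ← Finset.sum_div, hEsum]
    have h3 : M * E / (N + 1) ≤ M / 4 := by
      rw [div_le_iff₀ hN0]
      nlinarith
    linarith
  have hover : ∑ i, (alg.law z₀).real (alg.earlySuccess (T (z i)) ε N) ≤ V := by
    refine sum_measureReal_le_of_card_le _ _ (fun i => hc.measurableSet_earlySuccess (z i) N) V
      fun p F hF => ?_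
    rcases F.eq_empty_or_nonempty with rfl | ⟨j, hj⟩
    -- The run need not have stopped, so there may be no recommendation; any `R` serves to show `0 ≤
    -- V`.
    · exact hV ∅ ∅ (by simp)
    · obtain ⟨t, _, ht, _⟩ := (alg.mem_earlySuccess_iff _ _ _ _).1 (hF j hj)
      refine hV (alg.recommend p.1 (history p.2 t)) F fun i hi => ?_
      obtain ⟨s, _, hs, hd⟩ := (alg.mem_earlySuccess_iff _ _ _ _).1 (hF i hi)
      rw [ht] at hs
      obtain rfl : t = s := by exact_mod_cast hs
      exact hd
  have hpow : ∀ i, secondMoment (z i) z₀ ^ N ≤ Real.exp (N * χ) := fun i =>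
    (pow_le_pow_left₀ (secondMoment_nonneg _ _) (hmom i) N).trans
      (one_add_pow_le_exp_mul (by linarith) N)
  have hsq : ∑ i, (alg.law (z i)).real (alg.earlySuccess (T (z i)) ε N) ^ 2 ≤
      V * Real.exp (N * χ) := by
    refine le_trans (Finset.sum_le_sum fun i _ =>
      (alg.law_real_sq_le (z i) z₀ (hac i) a (hc.measurableSet_earlySuccess (z i) N)
        (alg.determinedBy_earlySuccess (T (z i)) ε N)).trans
      (mul_le_mul_of_nonneg_left (hpow i) measureReal_nonneg)) ?_
    rw [← Finset.sum_mul]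
    exact mul_le_mul_of_nonneg_right hover (Real.exp_pos _).le
  -- Jensen across the family: the average success probability is large while the sum of its squares
  -- is at most `V * exp (N * χ)`.
  have hcs := sq_sum_le_card_mul_sum_sq (s := Finset.univ)
    (f := fun i => (alg.law (z i)).real (alg.earlySuccess (T (z i)) ε N))
  rw [Finset.card_univ, ← hM] at hcs
  have hmain : M ^ 2 * (1 / 16) ≤ M ^ 2 * Real.exp (N * χ - β) := by
    calc M ^ 2 * (1 / 16) = (M / 4) ^ 2 := by ring
      _ ≤ M * (V * Real.exp (N * χ)) :=
        (pow_le_pow_left₀ (by positivity) hsucc 2).trans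
          (hcs.trans (mul_le_mul_of_nonneg_left hsq hM0.le))
      _ ≤ M * ((Real.exp (-β) * M) * Real.exp (N * χ)) := by gcongr
      _ = M ^ 2 * Real.exp (N * χ - β) := by rw [sub_eq_add_neg, Real.exp_add]; ring
  have hlog := Real.log_le_log (by norm_num) (le_of_mul_le_mul_left hmain (by positivity))
  rw [Real.log_exp, one_div, Real.log_inv] at hlog
  refine ENNReal.ofReal_le_of_le_toReal ?_
  rw [← hEdef, div_le_iff₀ (by positivity)]
  nlinarith

end LearningAlgorithm

/-! ### Safe-action instances: divergence and separation -/

/-- The first player plays action `i + 1` with probability `w i` and action `0` otherwise; the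
second player plays action `0`. -/
noncomputable def safeActionProfile {d : ℕ} (w : Fin d → ℝ) (hw : ∀ i, 0 ≤ w i)
    (hw1 : ∑ i, w i ≤ 1) : Profile (d + 1) :=
  (⟨Fin.cons (1 - ∑ i, w i) w, by
      intro i
      refine Fin.cases ?_ (fun j => ?_) i
      · simpa using hw1
      · simpa using hw j, by simp [Fin.sum_univ_succ]⟩,
    ⟨Pi.single 0 1, single_mem_stdSimplex ℝ 0⟩)

theorem roundLaw_safeActionProfile_ac {d : ℕ} {w w' : Fin d → ℝ} (hw : ∀ i, 0 ≤ w i)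
    (hw1 : ∑ i, w i ≤ 1) (hw' : ∀ i, 0 < w' i) (hw1' : ∑ i, w' i < 1)
    (a : Fin (d + 1) × Fin (d + 1))
    (h : (roundLaw (safeActionProfile w' (fun i => (hw' i).le) hw1'.le)).real {a} = 0) :
    (roundLaw (safeActionProfile w hw hw1)).real {a} = 0 := by
  rw [roundLaw_real_singleton, mul_eq_zero] at h ⊢
  rcases h with h | h
  · exfalso
    obtain ⟨i, j⟩ := a
    revert h
    refine Fin.cases ?_ (fun k => ?_) i
    · simp only [safeActionProfile, Fin.cons_zero]
      intro h
      linarith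
    · simp only [safeActionProfile, Fin.cons_succ]
      intro h
      linarith [hw' k]
  · exact Or.inr h

/-- Expanding `w² / w' = 2w - w' + (w - w')² / w'` cancels the linear terms against those of the
safe action. The risky actions contribute `κ²` times their total mass, and since this mass is at
most `1 / 2`, the safe action contributes no more. -/
theorem secondMoment_safeActionProfile_le {d : ℕ} {w w' : Fin d → ℝ} (hw : ∀ i, 0 ≤ w i)
    (hw1 : ∑ i, w i ≤ 1) (hw' : ∀ i, 0 < w' i) (hw1' : ∑ i, w' i ≤ 1) {κ : ℝ}
    (hhalf : ∑ i, w' i ≤ 1 / 2) (hκ : ∀ i, |w i - w' i| ≤ κ * w' i) :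
    secondMoment (safeActionProfile w hw hw1) (safeActionProfile w' (fun i => (hw' i).le) hw1') ≤
      1 + 2 * κ ^ 2 * ∑ i, w' i := by
  have heq : secondMoment (safeActionProfile w hw hw1)
      (safeActionProfile w' (fun i => (hw' i).le) hw1') =
      (1 - ∑ i, w i) ^ 2 / (1 - ∑ i, w' i) + ∑ i, w i ^ 2 / w' i := by
    simp only [secondMoment, roundLaw_real_singleton, Fintype.sum_prod_type, safeActionProfile]
    rw [Fin.sum_univ_succ]
    congr 1
    · rw [Fin.sum_univ_succ]
      simp
    · refine Finset.sum_congr rfl fun i _ => ?_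
      rw [Fin.sum_univ_succ]
      simp
  rw [heq]
  set p := ∑ i, w i
  set p' := ∑ i, w' i
  have hp'0 : 0 ≤ p' := Finset.sum_nonneg fun i _ => (hw' i).le
  have h1 : ∑ i, w i ^ 2 / w' i ≤ 2 * p - p' + κ ^ 2 * p' := by
    have : ∀ i, w i ^ 2 / w' i ≤ 2 * w i - w' i + κ ^ 2 * w' i := by
      intro i
      rw [div_le_iff₀ (hw' i)]
      have h2 := abs_le.1 (hκ i)
      nlinarith [sq_le_sq' h2.1 h2.2]
    refine (Finset.sum_le_sum fun i _ => this i).trans (le_of_eq ?_)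
    rw [Finset.sum_add_distrib, Finset.sum_sub_distrib, ← Finset.mul_sum, ← Finset.mul_sum]
  have hdiff : |p - p'| ≤ κ * p' := by
    rw [← Finset.sum_sub_distrib, Finset.mul_sum]
    exact (Finset.abs_sum_le_sum_abs _ _).trans (Finset.sum_le_sum fun i _ => hκ i)
  have hsq : (p - p') ^ 2 ≤ κ ^ 2 * p' ^ 2 := by
    have h2 := abs_le.1 hdiff
    nlinarith [sq_le_sq' h2.1 h2.2]
  have h3 : (1 - p) ^ 2 / (1 - p') ≤ 1 + p' - 2 * p + κ ^ 2 * p' := by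
    rw [div_le_iff₀ (by linarith)]
    have h4 : κ ^ 2 * p' ^ 2 ≤ κ ^ 2 * p' * (1 - p') := by
      have h5 : 0 ≤ κ ^ 2 * p' := by positivity
      nlinarith
    nlinarith
  linarith

/-- A vector of extra losses `b` of the actions `i + 1` over the safe action: tolerable for `w`, but
intolerable for `w'` even after a perturbation of all losses by `2ε`. -/
def SeparatedWeights {d : ℕ} (α ε : ℝ) (w w' : Fin d → ℝ) : Prop :=
  ∃ b : Fin d → ℝ, (∀ i, 0 ≤ b i ∧ b i ≤ 2) ∧ ∑ i, w i * b i ≤ α ∧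
    α ≤ ∑ i, w' i * (b i - 4 * ε)

/-- The matrix whose columns all equal `(-1, b - 1)`. -/
def extraLossMatrix {d : ℕ} (b : Fin d → ℝ) : PayoffMatrix (d + 1) :=
  fun i _ => (Fin.cons (-1) (fun k => b k - 1) : Fin (d + 1) → ℝ) i

theorem extraLossMatrix_mem_boundedMatrices {d : ℕ} {b : Fin d → ℝ}
    (hb : ∀ i, 0 ≤ b i ∧ b i ≤ 2) : extraLossMatrix b ∈ boundedMatrices (d + 1) := by
  intro i j
  refine Fin.cases ?_ (fun k => ?_) i
  · simp [extraLossMatrix]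
  · have h := hb k
    simp only [extraLossMatrix, Fin.cons_succ, Set.mem_Icc]
    constructor <;> linarith

theorem expectedLoss_pureStrategy_right {n : ℕ} (x : Fin n → ℝ) (A : PayoffMatrix n) (j : Fin n) :
    expectedLoss x A (pureStrategy j) = ∑ i, x i * A i j := by
  simp [expectedLoss, pureStrategy, Pi.single_apply]

theorem expectedLoss_extraLossMatrix {d : ℕ} (w b : Fin d → ℝ) (hw : ∀ i, 0 ≤ w i)
    (hw1 : ∑ i, w i ≤ 1) (j : Fin (d + 1)) :
    expectedLoss (safeActionProfile w hw hw1).1.1 (extraLossMatrix b) (pureStrategy j) =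
      -1 + ∑ i, w i * b i := by
  rw [expectedLoss_pureStrategy_right, Fin.sum_univ_succ]
  simp only [safeActionProfile, extraLossMatrix, Fin.cons_zero, Fin.cons_succ, mul_sub, mul_one,
    Finset.sum_sub_distrib]
  ring

theorem safeActionProfile_snd {d : ℕ} (w : Fin d → ℝ) (hw : ∀ i, 0 ≤ w i)
    (hw1 : ∑ i, w i ≤ 1) : (safeActionProfile w hw hw1).2.1 = pureStrategy 0 := rfl

theorem expectedLoss_extraLossMatrix_le {d : ℕ} {α : ℝ} {w b : Fin d → ℝ} (hw : ∀ i, 0 ≤ w i)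
    (hw1 : ∑ i, w i ≤ 1) (hb : ∀ i, 0 ≤ b i ∧ b i ≤ 2) (hα : ∑ i, w i * b i ≤ α)
    (i : Fin (d + 1)) :
    expectedLoss (safeActionProfile w hw hw1).1.1 (extraLossMatrix b)
        (safeActionProfile w hw hw1).2.1 ≤
      expectedLoss (pureStrategy i) (extraLossMatrix b) (safeActionProfile w hw hw1).2.1 + α := by
  rw [safeActionProfile_snd, expectedLoss_extraLossMatrix, expectedLoss_pureStrategy_right]
  have h := (extraLossMatrix_mem_boundedMatrices hb i 0).1
  simp only [pureStrategy, Pi.single_apply, ite_mul, one_mul, zero_mul, Finset.sum_ite_eq',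
    Finset.mem_univ, if_true]
  linarith

theorem le_edist_extraLossMatrix {d : ℕ} {α ε : ℝ} {w b : Fin d → ℝ} (hw : ∀ i, 0 ≤ w i)
    (hw1 : ∑ i, w i ≤ 1) (hpos : 0 < ∑ i, w i) (hα : α ≤ ∑ i, w i * (b i - 4 * ε))
    {A : PayoffMatrix (d + 1)}
    (hA : ∀ i, expectedLoss (safeActionProfile w hw hw1).1.1 A (safeActionProfile w hw hw1).2.1 ≤
      expectedLoss (pureStrategy i) A (safeActionProfile w hw hw1).2.1 + α) :
    ENNReal.ofReal (2 * ε) ≤ edist (extraLossMatrix b) A := by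
  by_contra hlt
  rw [not_le, edist_dist] at hlt
  have hdist : dist (extraLossMatrix b) A < 2 * ε :=
    (ENNReal.ofReal_lt_ofReal_iff_of_nonneg dist_nonneg).1 hlt
  have hent : ∀ i j, |extraLossMatrix b i j - A i j| < 2 * ε := fun i j =>
    ((dist_le_pi_dist (extraLossMatrix b i) (A i) j).trans
      (dist_le_pi_dist (extraLossMatrix b) A i)).trans_lt hdist
  have h0 := hA 0
  rw [safeActionProfile_snd, expectedLoss_pureStrategy_right, expectedLoss_pureStrategy_right,
    Fin.sum_univ_succ] at h0
  simp only [pureStrategy, Pi.single_apply, ite_mul, one_mul, zero_mul, Finset.sum_ite_eq',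
    Finset.mem_univ, if_true, safeActionProfile, Fin.cons_zero, Fin.cons_succ] at h0
  -- An extra loss is a difference of two entries, each moved by less than `2ε`.
  have hgap : ∀ i : Fin d, b i - 4 * ε < A i.succ 0 - A 0 0 := by
    intro i
    have h1 := abs_lt.1 (hent i.succ 0)
    have h2 := abs_lt.1 (hent 0 0)
    simp only [extraLossMatrix, Fin.cons_zero, Fin.cons_succ] at h1 h2
    linarith [h1.2, h2.1]
  have hlt' : ∑ i, w i * (b i - 4 * ε) < ∑ i, w i * (A i.succ 0 - A 0 0) := by
    refine Finset.sum_lt_sum (fun i _ => mul_le_mul_of_nonneg_left (hgap i).le (hw i)) ?_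
    obtain ⟨i, _, hi⟩ := Finset.exists_lt_of_sum_lt (f := fun _ => (0 : ℝ)) (s := Finset.univ)
      (by simpa using hpos)
    exact ⟨i, Finset.mem_univ i, mul_lt_mul_of_pos_left (hgap i) hi⟩
  simp only [mul_sub, Finset.sum_sub_distrib, ← Finset.sum_mul] at hlt' hα h0
  linarith

/-- A set-valued map on instances that separates instances with separated weights. -/
def Separates {d : ℕ} {P : Type} [PseudoEMetricSpace P] (α ε : ℝ)
    (feasible : Profile (d + 1) → Set P) : Prop :=
  ∀ (w w' : Fin d → ℝ) (hw : ∀ i, 0 ≤ w i) (hw1 : ∑ i, w i ≤ 1) (hw' : ∀ i, 0 ≤ w' i)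
    (hw1' : ∑ i, w' i ≤ 1), 0 < ∑ i, w' i → SeparatedWeights α ε w w' →
    ENNReal.ofReal (2 * ε) ≤ Metric.hausdorffEDist (feasible (safeActionProfile w hw hw1))
      (feasible (safeActionProfile w' hw' hw1'))

theorem le_hausdorffEDist_of_forall_le_edist {P : Type*} [PseudoEMetricSpace P] {S S' : Set P}
    {r : ℝ≥0∞} {x : P} (hx : x ∈ S) (h : ∀ y ∈ S', r ≤ edist x y) :
    r ≤ Metric.hausdorffEDist S S' :=
  (Metric.le_infEDist.2 h).trans (Metric.infEDist_le_hausdorffEDist_of_mem hx)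

/-- All columns of the witness agree, so the second player is indifferent and only the constraint of
the first player matters. -/
theorem separates_feasibleZeroSum {d : ℕ} {α ε : ℝ} (hα : 0 ≤ α) :
    Separates α ε (feasibleZeroSum (n := d + 1) α) := by
  rintro w w' hw hw1 hw' hw1' hpos ⟨b, hb, hbw, hbw'⟩
  refine le_hausdorffEDist_of_forall_le_edist (x := extraLossMatrix b)
    ⟨extraLossMatrix_mem_boundedMatrices hb, fun i j =>
      ⟨?_, expectedLoss_extraLossMatrix_le hw hw1 hb hbw i⟩⟩ ?_
  · rw [safeActionProfile_snd, expectedLoss_extraLossMatrix, expectedLoss_extraLossMatrix]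
    linarith
  · intro A hA
    exact le_edist_extraLossMatrix hw' hw1' hpos hbw' fun i => (hA.2 i 0).2

theorem separates_feasibleGeneralSum {d : ℕ} {α ε : ℝ} (hα : 0 ≤ α) :
    Separates α ε (feasibleGeneralSum (n := d + 1) α) := by
  rintro w w' hw hw1 hw' hw1' hpos ⟨b, hb, hbw, hbw'⟩
  refine le_hausdorffEDist_of_forall_le_edist (x := (extraLossMatrix b, 0))
    ⟨extraLossMatrix_mem_boundedMatrices hb, fun i j => by simp,
      expectedLoss_extraLossMatrix_le hw hw1 hb hbw, fun j => ?_⟩ ?_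
  · simpa [expectedLoss] using hα
  · rintro ⟨A, B⟩ hA
    exact (le_edist_extraLossMatrix hw' hw1' hpos hbw' hA.2.2.1).trans (le_max_left _ _)

/-! ### The scaled instances -/

theorem sum_const_div {d : ℕ} (hd : 1 ≤ d) (p : ℝ) : ∑ _i : Fin d, p / d = p := by
  have : (d : ℝ) ≠ 0 := by positivity
  rw [Finset.sum_const, Finset.card_univ, Fintype.card_fin, nsmul_eq_mul, mul_div_cancel₀ _ this]

theorem separatedWeights_const {d : ℕ} (hd : 1 ≤ d) {α ε : ℝ} (hα : 0 < α) (hε : 0 < ε)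
    (hε' : ε ≤ 1 / 128) {j k : ℕ} (hjk : j < k) (hk : k ≤ 8) :
    SeparatedWeights (d := d) α ε (fun _ => α * (1 + 16 * ε * j) / d)
      (fun _ => α * (1 + 16 * ε * k) / d) := by
  have hj1 : (j : ℝ) + 1 ≤ k := by exact_mod_cast hjk
  have hk8 : (k : ℝ) ≤ 8 := by exact_mod_cast hk
  have hj0 : (0 : ℝ) ≤ j := j.cast_nonneg
  have hs : 1 ≤ 1 + 16 * ε * j := by nlinarith [mul_nonneg hε.le hj0]
  have hs0 : 0 < 1 + 16 * ε * j := by linarith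
  -- This constant makes the regret under the smaller weights exactly `α`. As both scale factors are
  -- at most `2`, the slack `4ε` costs at most `16ε`, the gap between consecutive factors.
  refine ⟨fun _ => 1 / (1 + 16 * ε * j), fun _ => ⟨by positivity, ?_⟩, ?_, ?_⟩
  · rw [div_le_iff₀ hs0]
    linarith
  · rw [← Finset.sum_mul, sum_const_div hd, mul_assoc, mul_one_div_cancel hs0.ne', mul_one]
  · rw [← Finset.sum_mul, sum_const_div hd, mul_assoc]
    refine le_mul_of_one_le_right hα.le ?_
    have hmain : (1 + 16 * ε * j) ≤ (1 + 16 * ε * k) * (1 - 4 * ε * (1 + 16 * ε * j)) := by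
      have h1 : 16 * ε * j ≤ 1 := by nlinarith
      have h2 : 16 * ε * k ≤ 1 := by nlinarith
      have h3 : 0 ≤ 16 * ε * j := by positivity
      have h4 : 0 ≤ 16 * ε * k := by positivity
      have h5 : (1 + 16 * ε * k) * (1 + 16 * ε * j) ≤ 2 * 2 := by
        apply mul_le_mul <;> linarith
      have h6 : 4 * ε * ((1 + 16 * ε * k) * (1 + 16 * ε * j)) ≤ 4 * ε * (2 * 2) :=
        mul_le_mul_of_nonneg_left h5 (by positivity)
      have h7 : 16 * ε * (j + 1) ≤ 16 * ε * k := mul_le_mul_of_nonneg_left hj1 (by positivity)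
      linarith
    have heq : (1 + 16 * ε * k) * (1 / (1 + 16 * ε * j) - 4 * ε) =
        (1 + 16 * ε * k) * (1 - 4 * ε * (1 + 16 * ε * j)) / (1 + 16 * ε * j) := by
      field_simp
    rw [heq, le_div_iff₀ hs0, one_mul]
    exact hmain

/-- One instance at which every correct algorithm needs many samples. -/
theorem exists_hard_instance {d : ℕ} (hd : 1 ≤ d) {α ε : ℝ} (hα : 0 < α) (hα' : α < 1 / 4)
    (hε : 0 < ε) (hε' : ε ≤ 1 / 128) :
    ∃ z₀ : Profile (d + 1), ∀ (P : Type) [PseudoEMetricSpace P]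
      (feasible : Profile (d + 1) → Set P), Separates α ε feasible →
      ∀ (δ : ℝ), 0 < δ → δ ≤ 1 / 2 → ∀ alg : LearningAlgorithm (d + 1) P,
        alg.IsCorrect feasible ε δ →
        ENNReal.ofReal (Real.log (1 / δ) / (32 * (65536 * (ε ^ 2 * α)))) ≤
          alg.expectedSamples z₀ := by
  have hd0 : (0 : ℝ) < d := by positivity
  have hs1 : ∀ k : ℕ, 1 ≤ 1 + 16 * ε * k := fun k => by
    nlinarith [mul_nonneg hε.le (Nat.cast_nonneg (α := ℝ) k)]
  have hs2 : ∀ k : ℕ, k ≤ 8 → 1 + 16 * ε * k ≤ 2 := fun k hk => by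
    have : (k : ℝ) ≤ 8 := by exact_mod_cast hk
    nlinarith [Nat.cast_nonneg (α := ℝ) k]
  have hpos : ∀ k : ℕ, 0 < α * (1 + 16 * ε * k) := fun k =>
    mul_pos hα (by linarith [hs1 k])
  have hle : ∀ k : ℕ, k ≤ 8 → α * (1 + 16 * ε * k) ≤ 2 * α := fun k hk => by
    nlinarith [hs2 k hk]
  have hsum : ∀ k : ℕ, ∑ _i : Fin d, α * (1 + 16 * ε * k) / d = α * (1 + 16 * ε * k) :=
    fun k => sum_const_div hd _
  have hsum1 : ∀ k : ℕ, k ≤ 8 → ∑ _i : Fin d, α * (1 + 16 * ε * k) / d < 1 := fun k hk => by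
    rw [hsum k]
    linarith [hle k hk]
  let z : ∀ k : ℕ, k ≤ 8 → Profile (d + 1) := fun k hk =>
    safeActionProfile (fun _ => α * (1 + 16 * ε * k) / d)
      (fun _ => (div_pos (hpos k) hd0).le) (hsum1 k hk).le
  refine ⟨z 0 (by norm_num), fun P _ feasible hsep δ hδ hδ' alg hc => ?_⟩
  have hlt : ∀ (j k : ℕ) (hj : j ≤ 8) (hk : k ≤ 8), j < k →
      ENNReal.ofReal (2 * ε) ≤
        Metric.hausdorffEDist (feasible (z j hj)) (feasible (z k hk)) := fun j k hj hk hjk =>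
    hsep _ _ _ _ _ _ (by rw [hsum k]; exact hpos k)
      (separatedWeights_const hd hα hε hε' hjk hk)
  refine hc.log_div_le_expectedSamples hε.le hδ hδ' (by positivity) (0, 0) (z 0 (by norm_num))
    (fun k => z (k + 1) k.2) (fun k => hlt 0 (k + 1) (by norm_num) k.2 (Nat.succ_pos _))
    (fun j k hjk => ?_) (fun k a => ?_) fun k => ?_
  · rcases lt_or_gt_of_ne hjk with h | h
    · exact hlt (j + 1) (k + 1) j.2 k.2 (Nat.succ_lt_succ h)
    · rw [Metric.hausdorffEDist_comm]
      exact hlt (k + 1) (j + 1) k.2 j.2 (Nat.succ_lt_succ h)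
  · exact roundLaw_safeActionProfile_ac _ _ (fun _ => div_pos (hpos _) hd0) (hsum1 _ k.2) a
  · have hk8 : ((k : ℕ) + 1 : ℕ) ≤ (8 : ℝ) := by exact_mod_cast k.2
    refine (secondMoment_safeActionProfile_le (κ := 128 * ε) _ _
      (fun _ => div_pos (hpos _) hd0) (hsum1 _ k.2).le ?_ fun i => ?_).trans ?_
    · rw [hsum]
      linarith [hle _ k.2]
    · rw [← sub_div, ← mul_div_assoc, abs_div, abs_of_pos hd0]
      refine div_le_div_of_nonneg_right ?_ hd0.le
      rw [abs_sub_comm, abs_of_nonneg]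
      · have h1 : α * (16 * ε * ((k : ℕ) + 1 : ℕ)) ≤ α * (128 * ε) :=
          mul_le_mul_of_nonneg_left (by nlinarith) hα.le
        have h2 : 128 * ε * α ≤ 128 * ε * (α * (1 + 16 * ε * ((k : ℕ) + 1 : ℕ))) :=
          mul_le_mul_of_nonneg_left (le_mul_of_one_le_right hα.le (hs1 _)) (by positivity)
        push_cast at h1 h2 ⊢
        linarith
      · have h1 : 0 ≤ α * (16 * ε * ((k : ℕ) + 1 : ℕ)) := by positivity
        push_cast at h1 ⊢
        linarith
    · rw [hsum]
      have h1 : 2 * (128 * ε) ^ 2 * (α * (1 + 16 * ε * ((k : ℕ) + 1 : ℕ))) ≤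
          2 * (128 * ε) ^ 2 * (2 * α) :=
        mul_le_mul_of_nonneg_left (hle _ k.2) (by positivity)
      linarith

/-! ### The hypercube of instances -/

/-- Weights of total about `4α/3` whose relative deviation `± 64 ε` is encoded by `σ`. -/
noncomputable def signedWeights {d : ℕ} (α ε : ℝ) (σ : Fin d → Bool) (i : Fin d) : ℝ :=
  4 * α / 3 / d * (1 + 64 * ε * if σ i then 1 else -1)

theorem abs_signedWeights_sub_le {d : ℕ} {α ε : ℝ} (hα : 0 < α) (hε : 0 < ε)
    (σ : Fin d → Bool) (i : Fin d) :
    |signedWeights α ε σ i - 4 * α / 3 / d| ≤ 64 * ε * (4 * α / 3 / d) := by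
  have h : signedWeights α ε σ i - 4 * α / 3 / d =
      4 * α / 3 / d * (64 * ε) * if σ i then 1 else -1 := by
    rw [signedWeights]
    ring
  rw [h, abs_mul, abs_of_nonneg (by positivity : 0 ≤ 4 * α / 3 / d * (64 * ε))]
  have : |(if σ i then 1 else -1 : ℝ)| = 1 := by split_ifs <;> simp
  rw [this, mul_one, mul_comm]

theorem signedWeights_bounds {d : ℕ} {α ε : ℝ} (hα : 0 < α) (hε : 0 < ε)
    (hε' : ε ≤ 1 / 128) (σ : Fin d → Bool) (i : Fin d) :
    2 * α / 3 / d ≤ signedWeights α ε σ i ∧ signedWeights α ε σ i ≤ 2 * α / d := by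
  have h := abs_le.1 (abs_signedWeights_sub_le hα hε σ i)
  have h1 : 64 * ε * (4 * α / 3 / d) ≤ 1 / 2 * (4 * α / 3 / d) :=
    mul_le_mul_of_nonneg_right (by linarith) (by positivity)
  have e1 : 2 * α / 3 / (d : ℝ) = 1 / 2 * (4 * α / 3 / d) := by ring
  have e2 : 2 * α / (d : ℝ) = 3 / 2 * (4 * α / 3 / d) := by ring
  rw [e1, e2]
  constructor <;> linarith [h.1, h.2]

theorem sum_signedWeights_bounds {d : ℕ} (hd : 1 ≤ d) {α ε : ℝ} (hα : 0 < α) (hε : 0 < ε)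
    (hε' : ε ≤ 1 / 128) (σ : Fin d → Bool) :
    2 * α / 3 ≤ ∑ i, signedWeights α ε σ i ∧ ∑ i, signedWeights α ε σ i ≤ 2 * α := by
  constructor
  · rw [← sum_const_div hd (2 * α / 3)]
    exact Finset.sum_le_sum fun i _ => (signedWeights_bounds hα hε hε' σ i).1
  · rw [← sum_const_div hd (2 * α)]
    exact Finset.sum_le_sum fun i _ => (signedWeights_bounds hα hε hε' σ i).2

/-- Sign vectors at Hamming distance at least `d / 4` give separated weights, if the second one
has the larger total. -/
theorem separatedWeights_signedWeights {d : ℕ} (hd : 1 ≤ d) {α ε : ℝ} (hα : 0 < α)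
    (hε : 0 < ε) (hε' : ε ≤ 1 / 128) {σ σ' : Fin d → Bool} (hdist : d ≤ 4 * hammingDist σ σ')
    (hle : ∑ i, signedWeights α ε σ i ≤ ∑ i, signedWeights α ε σ' i) :
    SeparatedWeights α ε (signedWeights α ε σ) (signedWeights α ε σ') := by
  have hd0 : (0 : ℝ) < d := by positivity
  set u : ℝ := 4 * α / 3 / d with hu
  have hu0 : 0 < u := by positivity
  have hud : u * d = 4 * α / 3 := by rw [hu]; field_simp
  set S := Finset.univ.filter fun i => σ i = false ∧ σ' i = true
  set S' := Finset.univ.filter fun i => σ i = true ∧ σ' i = false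
  have hcard : S.card + S'.card = hammingDist σ σ' := by
    rw [hammingDist, ← Finset.card_union_of_disjoint]
    · congr 1
      ext i
      simp only [S, S', Finset.mem_union, Finset.mem_filter, Finset.mem_univ, true_and]
      cases σ i <;> cases σ' i <;> simp
    · rw [Finset.disjoint_left]
      intro i hi hi'
      simp only [S, S', Finset.mem_filter, Finset.mem_univ, true_and] at hi hi'
      simp [hi.1] at hi'
  have hpoint : ∀ i, signedWeights α ε σ' i - signedWeights α ε σ i =
      128 * ε * u * ((if i ∈ S then 1 else 0) - (if i ∈ S' then 1 else 0)) := by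
    intro i
    simp only [signedWeights, S, S', Finset.mem_filter, Finset.mem_univ, true_and, ← hu]
    cases σ i <;> cases σ' i <;> simp <;> ring
  have hdiff : ∑ i, signedWeights α ε σ' i - ∑ i, signedWeights α ε σ i =
      128 * ε * u * (S.card - S'.card) := by
    rw [← Finset.sum_sub_distrib, Finset.sum_congr rfl fun i _ => hpoint i, ← Finset.mul_sum,
      Finset.sum_sub_distrib]
    simp
  -- The larger total of `σ'` means that at least half of the differing coordinates, hence at least
  -- `d / 8`, go up from `σ` to `σ'`.
  have hSS : (S'.card : ℝ) ≤ S.card := by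
    have h1 : 0 ≤ 128 * ε * u * ((S.card : ℝ) - S'.card) := by rw [← hdiff]; linarith
    have h2 : 0 < 128 * ε * u := by positivity
    linarith [nonneg_of_mul_nonneg_right h1 h2]
  have hScard : (d : ℝ) ≤ 8 * S.card := by
    have h1 : (d : ℝ) ≤ 4 * (S.card + S'.card) := by
      rw [← hcard] at hdist
      exact_mod_cast hdist
    linarith
  have hSd : (S.card : ℝ) ≤ d := by
    have h := Finset.card_le_univ S
    rw [Fintype.card_fin] at h
    exact_mod_cast h
  obtain ⟨hp1, hp2⟩ := sum_signedWeights_bounds hd hα hε hε' σ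
  obtain ⟨hp1', hp2'⟩ := sum_signedWeights_bounds hd hα hε hε' σ'
  have hwS : ∑ i ∈ S, signedWeights α ε σ i = S.card * (u * (1 - 64 * ε)) := by
    rw [← nsmul_eq_mul]
    refine Finset.sum_eq_card_nsmul fun i hi => ?_
    simp only [S, Finset.mem_filter] at hi
    rw [signedWeights, hi.2.1, ← hu]
    simp only [Bool.false_eq_true, if_false]
    ring
  have hwS' : ∑ i ∈ S, signedWeights α ε σ' i = S.card * (u * (1 + 64 * ε)) := by
    rw [← nsmul_eq_mul]
    refine Finset.sum_eq_card_nsmul fun i hi => ?_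
    simp only [S, Finset.mem_filter] at hi
    rw [signedWeights, hi.2.2, ← hu]
    simp
  have hsplit : ∀ (w : Fin d → ℝ) (b c : ℝ),
      ∑ i, w i * (b + (if i ∈ S then 1 / 2 else 0) - c) =
        (∑ i, w i) * (b - c) + 1 / 2 * ∑ i ∈ S, w i := by
    intro w b c
    have h1 : ∀ i, w i * (b + (if i ∈ S then 1 / 2 else 0) - c) =
        w i * (b - c) + 1 / 2 * (if i ∈ S then w i else 0) := by
      intro i
      split_ifs <;> ring
    rw [Finset.sum_congr rfl fun i _ => h1 i, Finset.sum_add_distrib, ← Finset.sum_mul,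
      ← Finset.mul_sum]
    simp
  set p := ∑ i, signedWeights α ε σ i
  set p' := ∑ i, signedWeights α ε σ' i
  -- Actions in `S` get a bonus loss `1 / 2`, and `b₀` makes the regret under `σ` exactly `α`.
  -- Totals in `[2α / 3, 2α]` keep `b₀` in `[0, 3 / 2]`.
  set b₀ := (α - 1 / 2 * ∑ i ∈ S, signedWeights α ε σ i) / p with hb₀
  have hp0 : 0 < p := by linarith
  have hSu : S.card * u ≤ 4 * α / 3 := by
    rw [← hud, mul_comm u]
    exact mul_le_mul_of_nonneg_right hSd hu0.le
  have hSu' : α / 6 ≤ S.card * u := by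
    have h := mul_le_mul_of_nonneg_right hScard hu0.le
    linarith
  have hwS_nonneg : 0 ≤ ∑ i ∈ S, signedWeights α ε σ i := by
    rw [hwS]
    exact mul_nonneg (by positivity) (mul_nonneg hu0.le (by linarith))
  have hwS_le : ∑ i ∈ S, signedWeights α ε σ i ≤ 4 * α / 3 := by
    rw [hwS]
    have h : 0 ≤ S.card * u * (64 * ε) := by positivity
    linarith
  have hb0 : 0 ≤ b₀ := div_nonneg (by linarith) hp0.le
  have hb1 : b₀ ≤ 3 / 2 := by
    rw [hb₀, div_le_iff₀ hp0]
    linarith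
  have hbp : p * b₀ = α - 1 / 2 * ∑ i ∈ S, signedWeights α ε σ i :=
    mul_div_cancel₀ _ hp0.ne'
  refine ⟨fun i => b₀ + if i ∈ S then 1 / 2 else 0, fun i => ?_, ?_, ?_⟩
  · dsimp only
    split_ifs <;> constructor <;> linarith
  · have h := hsplit (signedWeights α ε σ) b₀ 0
    simp only [sub_zero] at h
    rw [h]
    linarith
  -- Under `σ'` the bonus gains `64ε * |S| * u ≥ 64εα / 6`, which exceeds the perturbation cost `4ε
  -- * p' ≤ 8εα`.
  · rw [hsplit, hwS']
    have h1 : p * b₀ ≤ p' * b₀ := mul_le_mul_of_nonneg_right hle hb0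
    have h2 : p' * (4 * ε) ≤ 2 * α * (4 * ε) := mul_le_mul_of_nonneg_right hp2' (by positivity)
    have h3 : α / 6 * (64 * ε) ≤ S.card * u * (64 * ε) :=
      mul_le_mul_of_nonneg_right hSu' (by positivity)
    rw [hbp, hwS] at h1
    have h4 : 0 < α * ε := by positivity
    linarith

theorem sum_pow_hammingDist {d : ℕ} (t : ℝ) (σ₀ : Fin d → Bool) :
    ∑ σ : Fin d → Bool, t ^ hammingDist σ σ₀ = (1 + t) ^ d := by
  have h : ∀ σ : Fin d → Bool, t ^ hammingDist σ σ₀ = ∏ i, if σ i ≠ σ₀ i then t else 1 := by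
    intro σ
    rw [hammingDist, Finset.prod_ite]
    simp
  simp only [h]
  rw [← Fintype.piFinset_univ,
    ← Finset.prod_univ_sum (fun _ => Finset.univ) (fun i s => if s ≠ σ₀ i then t else 1)]
  have h1 : ∀ i : Fin d, ∑ s : Bool, (if s ≠ σ₀ i then t else 1) = 1 + t := by
    intro i
    cases σ₀ i <;> simp [add_comm]
  rw [Finset.prod_congr rfl fun i _ => h1 i]
  simp

/-- A set of sign vectors of diameter less than `d / 4` is exponentially small in the cube. -/
theorem card_le_of_hammingDist_lt {d : ℕ} (F : Finset (Fin d → Bool))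
    (hF : ∀ σ ∈ F, ∀ σ' ∈ F, 4 * hammingDist σ σ' < d) :
    (F.card : ℝ) ≤ Real.exp (-(d / 10)) * Fintype.card (Fin d → Bool) := by
  rcases F.eq_empty_or_nonempty with rfl | ⟨σ₀, hσ₀⟩
  · simp only [Finset.card_empty, Nat.cast_zero]
    positivity
  -- A Chernoff bound around a fixed `σ₀ ∈ F`: each member has weight `(1 / 4) ^ hammingDist σ σ₀`,
  -- at least `(7 / 10) ^ d` because `(7 / 10) ^ 4 ≤ 1 / 4`. The final comparison is `5 / 4 ≤ 2 * (9
  -- / 10) * (7 / 10)`.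
  have h1 : (F.card : ℝ) * (7 / 10) ^ d ≤ (5 / 4) ^ d := by
    calc (F.card : ℝ) * (7 / 10) ^ d = ∑ _σ ∈ F, (7 / 10 : ℝ) ^ d := by simp
      _ ≤ ∑ σ ∈ F, (1 / 4 : ℝ) ^ hammingDist σ σ₀ := by
        refine Finset.sum_le_sum fun σ hσ => ?_
        calc (7 / 10 : ℝ) ^ d ≤ (7 / 10) ^ (4 * hammingDist σ σ₀) :=
              pow_le_pow_of_le_one (by norm_num) (by norm_num) (hF σ hσ σ₀ hσ₀).le
          _ ≤ _ := by
              rw [pow_mul]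
              exact pow_le_pow_left₀ (by norm_num) (by norm_num) _
      _ ≤ ∑ σ, (1 / 4 : ℝ) ^ hammingDist σ σ₀ :=
        Finset.sum_le_univ_sum_of_nonneg fun σ => by positivity
      _ = (5 / 4) ^ d := by rw [sum_pow_hammingDist]; norm_num
  have h2 : (5 / 4 : ℝ) ^ d ≤ (Real.exp (-(d / 10)) * Fintype.card (Fin d → Bool)) *
      (7 / 10) ^ d := by
    have h3 : Real.exp (-((d : ℝ) / 10)) = Real.exp (-(1 / 10)) ^ d := by
      rw [← Real.exp_nat_mul]
      congr 1
      ring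
    have h4 : (9 / 10 : ℝ) ≤ Real.exp (-(1 / 10)) := by
      linarith [Real.add_one_le_exp (-(1 / 10 : ℝ))]
    rw [h3, Fintype.card_fun, Fintype.card_bool, Fintype.card_fin]
    push_cast
    rw [← mul_pow, ← mul_pow]
    exact pow_le_pow_left₀ (by norm_num) (by linarith) _
  exact le_of_mul_le_mul_right (h1.trans h2) (by positivity)

/-- A family of instances on which every correct algorithm needs, on average, a number of samples
growing with the number of actions. -/
theorem exists_hard_family {d : ℕ} (hd : 1 ≤ d) {α ε : ℝ} (hα : 0 < α) (hα' : α < 1 / 4)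
    (hε : 0 < ε) (hε' : ε ≤ 1 / 128) :
    ∃ z : (Fin d → Bool) → Profile (d + 1), ∀ (P : Type) [PseudoEMetricSpace P]
      (feasible : Profile (d + 1) → Set P), Separates α ε feasible →
      ∀ (δ : ℝ), 0 < δ → δ ≤ 1 / 2 → ∀ alg : LearningAlgorithm (d + 1) P,
        alg.IsCorrect feasible ε δ →
        ENNReal.ofReal ((d / 10 - Real.log 16) / (4 * (16384 * (ε ^ 2 * α)))) ≤
          (Fintype.card (Fin d → Bool) : ℝ≥0∞)⁻¹ * ∑ σ, alg.expectedSamples (z σ) := by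
  have hd0 : (0 : ℝ) < d := by positivity
  have hw : ∀ (σ : Fin d → Bool) i, 0 ≤ signedWeights α ε σ i := fun σ i =>
    le_trans (by positivity) (signedWeights_bounds hα hε hε' σ i).1
  have hw1 : ∀ σ : Fin d → Bool, ∑ i, signedWeights α ε σ i ≤ 1 := fun σ => by
    linarith [(sum_signedWeights_bounds hd hα hε hε' σ).2]
  have hw0 : ∀ σ : Fin d → Bool, 0 < ∑ i, signedWeights α ε σ i := fun σ => by
    linarith [(sum_signedWeights_bounds hd hα hε hε' σ).1]
  have hr : ∀ _i : Fin d, 0 < 4 * α / 3 / d := fun _ => by positivity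
  have hr1 : ∑ _i : Fin d, 4 * α / 3 / d < 1 := by
    rw [sum_const_div hd]
    linarith
  refine ⟨fun σ => safeActionProfile (signedWeights α ε σ) (hw σ) (hw1 σ),
    fun P _ feasible hsep δ hδ hδ' alg hc => ?_⟩
  refine hc.sub_div_le_average_expectedSamples
    (V := Real.exp (-(d / 10)) * Fintype.card (Fin d → Bool)) hδ hδ' (by positivity) (0, 0)
    (safeActionProfile (fun _ => 4 * α / 3 / d) (fun i => (hr i).le) hr1.le) _
    (fun R F hF => card_le_of_hammingDist_lt F fun σ hσ σ' hσ' => ?_) le_rfl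
    (fun σ a => roundLaw_safeActionProfile_ac _ _ hr hr1 a) fun σ => ?_
  -- Two instances fitted by the same `R` have feasible sets at distance less than `2ε`, so their
  -- sign vectors must be close. Separation is directional, hence the case split on which total is
  -- larger.
  · by_contra hdist
    have hfar : ENNReal.ofReal (2 * ε) ≤ Metric.hausdorffEDist
        (feasible (safeActionProfile (signedWeights α ε σ) (hw σ) (hw1 σ)))
        (feasible (safeActionProfile (signedWeights α ε σ') (hw σ') (hw1 σ'))) := by
      rcases le_total (∑ i, signedWeights α ε σ i) (∑ i, signedWeights α ε σ' i) with h | h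
      · exact hsep _ _ _ _ _ _ (hw0 σ')
          (separatedWeights_signedWeights hd hα hε hε' (not_lt.1 hdist) h)
      · rw [Metric.hausdorffEDist_comm]
        rw [hammingDist_comm] at hdist
        exact hsep _ _ _ _ _ _ (hw0 σ)
          (separatedWeights_signedWeights hd hα hε hε' (not_lt.1 hdist) h)
    have h1 := hF σ hσ
    have h2 := hF σ' hσ'
    rw [Metric.hausdorffEDist_comm] at h2
    refine absurd hfar (not_le.2 ?_)
    rw [two_mul, ENNReal.ofReal_add hε.le hε.le]
    exact Metric.hausdorffEDist_triangle.trans_lt (ENNReal.add_lt_add h1 h2)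
  · refine (secondMoment_safeActionProfile_le (κ := 64 * ε) _ _ hr hr1.le ?_
      fun i => abs_signedWeights_sub_le hα hε σ i).trans ?_
    · rw [sum_const_div hd]
      linarith
    · rw [sum_const_div hd]
      have h : 0 < ε ^ 2 * α := by positivity
      linarith

/-! ### The mixed prior and the combined rate -/

theorem PMF.tsum_map_mul {A B : Type*} (p : PMF A) (f : A → B) (g : B → ℝ≥0∞) :
    ∑' b, p.map f b * g b = ∑' a, p a * g (f a) := by
  classical
  simp only [PMF.map_apply, ← ENNReal.tsum_mul_right]
  rw [ENNReal.tsum_comm]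
  refine tsum_congr fun a => ?_
  rw [tsum_eq_single (f a) fun b hb => by simp [hb]]
  simp

theorem PMF.exists_mem_support_le_of_le_tsum {B : Type*} (p : PMF B) (hp : p.support.Finite)
    (g : B → ℝ≥0∞) {K : ℝ≥0∞} (hK : K ≤ ∑' b, p b * g b) : ∃ b ∈ p.support, K ≤ g b := by
  obtain ⟨b, hb, hmax⟩ := Set.exists_max_image p.support g hp p.support_nonempty
  refine ⟨b, hb, hK.trans ?_⟩
  calc ∑' a, p a * g a ≤ ∑' a, p a * g b := by
        refine ENNReal.tsum_le_tsum fun a => ?_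
        by_cases ha : a ∈ p.support
        · exact mul_le_mul_right (hmax a ha) _
        · simp [(p.apply_eq_zero_iff a).2 ha]
    _ = g b := by rw [ENNReal.tsum_mul_right, p.tsum_coe, one_mul]

/-- The equal mixture of the point mass at `z₀` and of the uniform law on the family `z`. -/
noncomputable def mixedPrior {B I : Type} [Fintype I] [Nonempty I] (z₀ : B) (z : I → B) : PMF B :=
  (PMF.uniformOfFintype (Bool × I)).map fun s => if s.1 then z₀ else z s.2

theorem finite_support_mixedPrior {B I : Type} [Fintype I] [Nonempty I] (z₀ : B) (z : I → B) :
    (mixedPrior z₀ z).support.Finite := by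
  rw [mixedPrior, PMF.support_map]
  exact (Set.toFinite _).image _

theorem tsum_mixedPrior_mul {B I : Type} [Fintype I] [Nonempty I] (z₀ : B) (z : I → B)
    (g : B → ℝ≥0∞) :
    ∑' b, mixedPrior z₀ z b * g b =
      2⁻¹ * (g z₀ + (Fintype.card I : ℝ≥0∞)⁻¹ * ∑ i, g (z i)) := by
  rw [mixedPrior, PMF.tsum_map_mul, tsum_fintype, Fintype.sum_prod_type, Fintype.sum_bool]
  have hcard : (Fintype.card I : ℝ≥0∞) ≠ 0 := by simp
  have hinv : (2 * (Fintype.card I : ℝ≥0∞))⁻¹ = 2⁻¹ * (Fintype.card I : ℝ≥0∞)⁻¹ :=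
    ENNReal.mul_inv (by simp) (by simp)
  simp only [PMF.uniformOfFintype_apply, Fintype.card_prod, Fintype.card_bool, Nat.cast_mul,
    Nat.cast_ofNat, hinv, if_true, Bool.false_eq_true, if_false, ← Finset.mul_sum,
    Finset.sum_const, Finset.card_univ, nsmul_eq_mul]
  rw [mul_add, mul_assoc, mul_assoc, ← mul_assoc _ _ (g z₀),
    ENNReal.inv_mul_cancel hcard (by simp), one_mul]

theorem combined_rate_le (d : ℝ) {L : ℝ} (hL : Real.log 2 ≤ L) :
    2 * (1 / 2 ^ 29 * (d + 1 + L)) ≤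
      L / 2097152 + max 0 ((d / 10 - Real.log 16) / 65536) := by
  have h2 := Real.log_two_gt_d9
  have h2' := Real.log_two_lt_d9
  have h16 : Real.log 16 = 4 * Real.log 2 := by
    rw [show (16 : ℝ) = 2 ^ 4 by norm_num, Real.log_pow]
    norm_num
  -- For small `d` the cube bound may be void, but `L ≥ log 2` absorbs the bounded term `d + 1`;
  -- from `d = 56` on, `d / 10` dominates `log 16`.
  rcases le_total d 56 with h | h
  · have := le_max_left 0 ((d / 10 - Real.log 16) / 65536)
    linarith
  · have := le_max_right 0 ((d / 10 - Real.log 16) / 65536)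
    rw [h16] at this ⊢
    linarith

theorem ofReal_combined_rate_le {d L D : ℝ} (hL : Real.log 2 ≤ L) (hD : 0 < D)
    {A B : ℝ≥0∞} (hA : ENNReal.ofReal (L / (32 * (65536 * D))) ≤ A)
    (hB : ENNReal.ofReal ((d / 10 - Real.log 16) / (4 * (16384 * D))) ≤ B) :
    ENNReal.ofReal (1 / 2 ^ 29 * ((d + 1 + L) / D)) ≤ 2⁻¹ * (A + B) := by
  have hL0 : 0 ≤ L := (Real.log_nonneg (by norm_num)).trans hL
  have hsum : ENNReal.ofReal (2 * (1 / 2 ^ 29 * ((d + 1 + L) / D))) ≤ A + B := by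
    -- Truncating at `0` makes `ENNReal.ofReal` additive even when the cube bound is negative.
    have hB' : ENNReal.ofReal (max 0 ((d / 10 - Real.log 16) / (4 * (16384 * D)))) ≤ B := by
      rw [ENNReal.ofReal_max, ENNReal.ofReal_zero]
      exact max_le zero_le hB
    refine le_trans ?_ (add_le_add hA hB')
    rw [← ENNReal.ofReal_add (by positivity) (le_max_left _ _)]
    refine ENNReal.ofReal_le_ofReal ?_
    have h := div_le_div_of_nonneg_right (combined_rate_le d hL) hD.le
    rw [add_div, ← max_div_div_right hD.le, zero_div] at h
    have e1 : 2 * (1 / 2 ^ 29 * ((d + 1 + L) / D)) = 2 * (1 / 2 ^ 29 * (d + 1 + L)) / D := by ring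
    have e2 : L / (32 * (65536 * D)) = L / 2097152 / D := by rw [div_div]; ring
    have e3 : (d / 10 - Real.log 16) / (4 * (16384 * D)) =
        (d / 10 - Real.log 16) / 65536 / D := by rw [div_div]; ring
    rw [e1, e2, e3]
    exact h
  rw [ENNReal.ofReal_mul (by norm_num), ENNReal.ofReal_ofNat] at hsum
  have h2 := mul_le_mul_right hsum (2⁻¹ : ℝ≥0∞)
  rwa [← mul_assoc, ENNReal.inv_mul_cancel (by norm_num) (by norm_num), one_mul] at h2

theorem mainTheorem3 :
    ∃ c : ℝ, 0 < c ∧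
      ∀ (n : ℕ) (α ε : ℝ), 2 ≤ n → 0 < α → α < 1 / 4 → 0 < ε → ε ≤ 1 / 128 →
        ∃ (z₀ : Profile n) (ν : PMF (Profile n)), ν.support.Finite ∧
          ∀ δ : ℝ, 0 < δ → δ ≤ 1 / 2 →
            (∀ alg : LearningAlgorithm n (PayoffMatrix n × PayoffMatrix n),
              alg.IsCorrect (feasibleGeneralSum α) ε δ →
                ENNReal.ofReal (c * (Real.log (1 / δ) / (ε ^ 2 * α))) ≤
                    alg.expectedSamples z₀ ∧
                ENNReal.ofReal (c * ((n + Real.log (1 / δ)) / (ε ^ 2 * α))) ≤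
                    ∑' z, ν z * alg.expectedSamples z ∧
                ∃ z ∈ ν.support,
                  ENNReal.ofReal (c * ((n + Real.log (1 / δ)) / (ε ^ 2 * α))) ≤
                    alg.expectedSamples z) ∧
            (∀ alg : LearningAlgorithm n (PayoffMatrix n),
              alg.IsCorrect (feasibleZeroSum α) ε δ →
                ENNReal.ofReal (c * (Real.log (1 / δ) / (ε ^ 2 * α))) ≤
                    alg.expectedSamples z₀ ∧
                ENNReal.ofReal (c * ((n + Real.log (1 / δ)) / (ε ^ 2 * α))) ≤
                    ∑' z, ν z * alg.expectedSamples z ∧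
                ∃ z ∈ ν.support,
                  ENNReal.ofReal (c * ((n + Real.log (1 / δ)) / (ε ^ 2 * α))) ≤
                    alg.expectedSamples z) := by
  refine ⟨1 / 2 ^ 29, by positivity, fun n α ε hn hα hα' hε hε' => ?_⟩
  obtain ⟨d, rfl⟩ : ∃ d, n = d + 1 := ⟨n - 1, by omega⟩
  have hd : 1 ≤ d := by omega
  obtain ⟨z₀, hz₀⟩ := exists_hard_instance hd hα hα' hε hε'
  obtain ⟨z, hz⟩ := exists_hard_family hd hα hα' hε hε'
  have hD : 0 < ε ^ 2 * α := by positivity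
  have key : ∀ (P : Type) [PseudoEMetricSpace P] (feasible : Profile (d + 1) → Set P),
      Separates α ε feasible → ∀ δ : ℝ, 0 < δ → δ ≤ 1 / 2 →
      ∀ alg : LearningAlgorithm (d + 1) P, alg.IsCorrect feasible ε δ →
        ENNReal.ofReal (1 / 2 ^ 29 * (Real.log (1 / δ) / (ε ^ 2 * α))) ≤
            alg.expectedSamples z₀ ∧
        ENNReal.ofReal (1 / 2 ^ 29 * (((d + 1 : ℕ) + Real.log (1 / δ)) / (ε ^ 2 * α))) ≤
            ∑' x, mixedPrior z₀ z x * alg.expectedSamples x ∧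
        ∃ x ∈ (mixedPrior z₀ z).support,
          ENNReal.ofReal (1 / 2 ^ 29 * (((d + 1 : ℕ) + Real.log (1 / δ)) / (ε ^ 2 * α))) ≤
            alg.expectedSamples x := by
    intro P _ feasible hsep δ hδ hδ' alg hc
    have hA := hz₀ P feasible hsep δ hδ hδ' alg hc
    have hL : Real.log 2 ≤ Real.log (1 / δ) := by
      refine Real.log_le_log (by norm_num) ?_
      rw [le_div_iff₀ hδ]
      linarith
    have hL0 : 0 ≤ Real.log (1 / δ) := (Real.log_nonneg (by norm_num)).trans hL
    have havg : ENNReal.ofReal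
        (1 / 2 ^ 29 * (((d + 1 : ℕ) + Real.log (1 / δ)) / (ε ^ 2 * α))) ≤
        ∑' x, mixedPrior z₀ z x * alg.expectedSamples x := by
      rw [tsum_mixedPrior_mul, Nat.cast_add_one]
      exact ofReal_combined_rate_le hL hD hA (hz P feasible hsep δ hδ hδ' alg hc)
    refine ⟨(ENNReal.ofReal_le_ofReal ?_).trans hA, havg,
      PMF.exists_mem_support_le_of_le_tsum _ (finite_support_mixedPrior z₀ z) _ havg⟩
    have h0 : 0 ≤ Real.log (1 / δ) / (ε ^ 2 * α) := by positivity
    have h1 : Real.log (1 / δ) / (32 * (65536 * (ε ^ 2 * α))) =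
        1 / (32 * 65536) * (Real.log (1 / δ) / (ε ^ 2 * α)) := by
      rw [← mul_assoc, div_mul_div_comm, one_mul]
    rw [h1]
    exact mul_le_mul_of_nonneg_right (by norm_num) h0
  exact ⟨z₀, mixedPrior z₀ z, finite_support_mixedPrior z₀ z, fun δ hδ hδ' =>
    ⟨key _ _ (separates_feasibleGeneralSum hα.le) δ hδ hδ',
      key _ _ (separates_feasibleZeroSum hα.le) δ hδ hδ'⟩⟩
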